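/- **Setting.** Let $C>0$, $p>0$, and let $(a_k)_{k\ge1}$ be positive reals with $a_k\sim Ck^{p-1}$ as $k\to\infty$. For $N\ge 0$ let $\Omega_N$ be the set of partitions $\eta$ of $N$, let $n_k=n_k(\eta)$ be the number of summands of $\eta$ equal to $k$, and let $\mu_N$ be the Gibbs probability measure $$\mu_N(\eta)=c_N^{-1}\prod_{k=1}^N\frac{a_k^{n_k}}{n_k!},\qquad \eta\in\Omega_N,$$ where $c_N$ is the normalizing constant. Put $r_N=(C\Gamma(p+1))^{-1/(p+1)}N^{1/(p+1)}$ and, for $u\ge0$, $$\nu(u)=\sum_{u\le k\le N}n_k,\qquad \tilde\nu(u)=\frac{r_N}{N}\,\nu(r_Nu),\qquad \Gamma(s,u)=\int_u^\infty x^{s-1}e^{-x}dx,\qquad l(u)=\frac{\Gamma(p,u)}{\Gamma(p+1)},\qquad \Delta(u)=\tilde\nu(u)-l(u),$$ and $b_r(u)=C\,\Gamma(r+1,u)$ for $r>-1$. For $N\ge1$ let $\delta_N$ be the unique real solution of $\sum_{k=1}^N k a_k e^{-\delta_N k}=N$ (so that $\delta_N\sim 1/r_N$). Fix $q\ge1$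 and $0<u_1<\dots<u_q$, and let $M_j=\lceil u_jr_N\rceil$ for all $j$ and $N$, so that $\nu(M_j)=\nu(r_Nu_j)$. Define $$\hat\nu_j=\Big(C\int_0^{u_1}x^{p-1}e^{-x}dx\Big)^{1/2}\,\frac{\nu(M_j)-S_j}{\sqrt{S_0}},\qquad S_j=\sum_{k=M_j}^{N}a_ke^{-\delta_Nk}\ \ (1\le j\le q),\qquad S_0=\sum_{1\le k<M_1}a_ke^{-\delta_Nk}.$$ **Theorem 4.3.** As $N\to\infty$, under $\mu_N$: (i) (Central limit theorem.) The matrix $$e_{mk}=b_{p-1}(u_{\max(m,k)})-\frac{b_p(u_m)\,b_p(u_k)}{C\,\Gamma(p+2)},\qquad 1\le m,k\le q,$$ is positive semidefinite, and $(\hat\nu_1,\dots,\hat\nu_q)$ converges weakly to the $q$-dimensional Gaussian vector with mean zero and covariance matrix $(e_{mk})$. The same holds with $M_j=\lfloor u_jr_N\rfloor$ for all $j$ and $N$. (ii) (Relation to the fluctuations.) For each $j$ there are real sequences $\alpha_N\to1$ and $\varepsilon_N\to0$, not depending on $\eta$, such that for all large $N$ and all $\eta\in\Omega_N$ $$\hat\nu_j=\alpha_N\,\big(C\Gamma(p+1)N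 r_N^{-1}\big)^{1/2}\,\big(\Delta(u_j)+\varepsilon_N\big).$$ In particular $\hat\nu_j\sim\big(C\Gamma(p+1)Nr_N^{-1}\big)^{1/2}\Delta(u_j)$ along every sequence $\eta_N\in\Omega_N$ for which $|\Delta(u_j)|$ is eventually bounded below by a positive constant. (iii) (Limit shape.) $\mu_N$ has the limit shape $l$ under the scaling $r_N$. That is, $r_N>0$ for $N\ge1$, $r_N=o(N)$; $l$ is nonnegative, nonincreasing and continuous on $[0,\infty)$ with $\int_0^\infty l(u)\,du=1$; and for all $b>0$ and $\varepsilon>0$ $$\lim_{N\to\infty}\mu_N\big\{\eta:\ |\tilde\nu(u)-l(u)|<\varepsilon\ \text{ for all } u\in[0,b]\big\}=1.$$ -/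

import Mathlib

open Filter Topology MeasureTheory ProbabilityTheory Asymptotics

namespace GibbsPartition

noncomputable section

/-- The finite set of partitions of `N` carries the discrete σ-algebra. -/
instance instMeasurableSpacePartition (N : ℕ) : MeasurableSpace (Nat.Partition N) := ⊤

instance instDiscreteMeasurableSpacePartition (N : ℕ) :
    DiscreteMeasurableSpace (Nat.Partition N) := ⟨fun _ => trivial⟩

/-- `n_k(η)`: the number of summands of the partition `η` that are equal to `k`. -/
def mult {N : ℕ} (η : Nat.Partition N) (k : ℕ) : ℕ := η.parts.count k

/-- The weight `a₁^{n₁} ⋯ a_N^{n_N} / (n₁! ⋯ n_N!)` of a partition. -/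
def weight (a : ℕ → ℝ) {N : ℕ} (η : Nat.Partition N) : ℝ :=
  ∏ k ∈ Finset.Icc 1 N, a k ^ mult η k / ((mult η k).factorial : ℝ)

/-- The partition function `c_N`, the sum of all weights. -/
def partitionFunction (a : ℕ → ℝ) (N : ℕ) : ℝ := ∑ η : Nat.Partition N, weight a η

lemma weight_pos {a : ℕ → ℝ} (ha : ∀ k, 1 ≤ k → 0 < a k) {N : ℕ} (η : Nat.Partition N) :
    0 < weight a η :=
  Finset.prod_pos fun k hk =>
    div_pos (pow_pos (ha k (Finset.mem_Icc.1 hk).1) _) (Nat.cast_pos.2 (Nat.factorial_pos _))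

lemma partitionFunction_pos {a : ℕ → ℝ} (ha : ∀ k, 1 ≤ k → 0 < a k) (N : ℕ) :
    0 < partitionFunction a N :=
  Finset.sum_pos (fun η _ => weight_pos ha η) Finset.univ_nonempty

/-- The Gibbs distribution `μ_N(η) = c_N⁻¹ ∏ a_k^{n_k} / n_k!` on the partitions of `N`, for a
positive parameter function `a`. -/
def gibbs (a : ℕ → ℝ) (ha : ∀ k, 1 ≤ k → 0 < a k) (N : ℕ) : PMF (Nat.Partition N) :=
  PMF.ofFintype (fun η => ENNReal.ofReal (weight a η / partitionFunction a N)) (by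
    rw [← ENNReal.ofReal_sum_of_nonneg
      (fun η _ => (div_pos (weight_pos ha η) (partitionFunction_pos ha N)).le),
      ← Finset.sum_div, ← ENNReal.ofReal_one]
    exact congrArg _ (div_self (partitionFunction_pos ha N).ne'))

/-- The boundary `ν(u; η) = ∑_{u ≤ k ≤ N} n_k(η)` of the Young diagram of `η`. -/
def young {N : ℕ} (η : Nat.Partition N) (u : ℝ) : ℝ :=
  ∑ k ∈ Finset.Icc 1 N with u ≤ ((k : ℕ) : ℝ), (mult η k : ℝ)

/-- The scaled Young diagram `ν̃(u; η) = (r / N) ν(r u; η)`, with scaling factor `r`. -/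
def scaledYoung {N : ℕ} (r : ℝ) (η : Nat.Partition N) (u : ℝ) : ℝ :=
  r / (N : ℝ) * young η (r * u)

/-- The space of nonnegative nonincreasing functions on `[0, ∞)` with integral one. A function
is given on all of `ℝ`, but only its values on `[0, ∞)` matter. -/
structure IsShape (l : ℝ → ℝ) : Prop where
  nonneg : ∀ u, 0 ≤ u → 0 ≤ l u
  antitone : AntitoneOn l (Set.Ici 0)
  integrable : IntegrableOn l (Set.Ioi 0)
  integral_eq_one : ∫ u in Set.Ioi (0 : ℝ), l u = 1

/-- `l` is the limit shape of the sequence `μ` of probability measures on partitions under the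
scaling `r`: it is a continuous shape, `r_N > 0`, `r_N = o(N)`, and the random curve
`ν̃` converges to `l` in probability, uniformly on compact subsets of `[0, ∞)`. (Convergence
in probability to the constant `l` is the same as weak convergence of the laws of `ν̃` to the
point mass at `l`.) -/
structure IsLimitShape (μ : (N : ℕ) → PMF (Nat.Partition N)) (r : ℕ → ℝ) (l : ℝ → ℝ) :
    Prop where
  isShape : IsShape l
  continuousOn : ContinuousOn l (Set.Ici 0)
  scaling_pos : ∀ N, 1 ≤ N → 0 < r N
  scaling_isLittleO : r =o[atTop] fun N : ℕ => (N : ℝ)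
  tendsto : ∀ b : ℝ, 0 < b → ∀ ε : ℝ, 0 < ε →
    Tendsto (fun N => (μ N).toMeasure
      {η | ∀ u ∈ Set.Icc (0 : ℝ) b, |scaledYoung (r N) η u - l u| < ε}) atTop (𝓝 1)

/-- The upper incomplete Gamma function `Γ(s, u) = ∫_u^∞ x^{s-1} e^{-x} dx`. -/
def upperGamma (s u : ℝ) : ℝ := ∫ x in Set.Ioi u, x ^ (s - 1) * Real.exp (-x)

/-- The scaling `r_N = (C Γ(p+1))^{-1/(p+1)} N^{1/(p+1)}`. -/
def scaling (C p : ℝ) (N : ℕ) : ℝ :=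
  ((C * Real.Gamma (p + 1)) ^ (1 / (p + 1)))⁻¹ * (N : ℝ) ^ (1 / (p + 1))

/-- The curve `l(u) = Γ(p, u) / Γ(p+1)`. -/
def limitCurve (p u : ℝ) : ℝ := upperGamma p u / Real.Gamma (p + 1)

/-- `b_r(u) = C Γ(r+1, u)`. -/
def bFun (C r u : ℝ) : ℝ := C * upperGamma (r + 1) u

/-- The limiting covariance matrix
`e_{mk} = b_{p-1}(u_{max(m,k)}) - b_p(u_m) b_p(u_k) / (C Γ(p+2))`. -/
def limitCov (C p : ℝ) {q : ℕ} (u : Fin q → ℝ) : Matrix (Fin q) (Fin q) ℝ :=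
  Matrix.of fun m k => bFun C (p - 1) (u (max m k)) -
    bFun C p (u m) * bFun C p (u k) / (C * Real.Gamma (p + 2))

/-- `f₀(s) = C ∫_0^{u₁} x^s e^{-x} dx`. -/
def fZero (C s u₁ : ℝ) : ℝ := C * ∫ x in (0 : ℝ)..u₁, x ^ s * Real.exp (-x)

/-- `S₀ = ∑_{1 ≤ k < M₁} a_k e^{-δ k}`. -/
def sumBelow (a : ℕ → ℝ) (δ : ℝ) (M₁ : ℕ) : ℝ :=
  ∑ k ∈ Finset.Ico 1 M₁, a k * Real.exp (-δ * k)

/-- `S_j = ∑_{M ≤ k ≤ N} a_k e^{-δ k}` for `M = M_j`, where `k ≥ 1`. -/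
def sumAbove (a : ℕ → ℝ) (δ : ℝ) (N M : ℕ) : ℝ :=
  ∑ k ∈ Finset.Icc 1 N with M ≤ k, a k * Real.exp (-δ * k)

/-- The scaled quantity `√f₀(p-1) (ν_j - S_j) / √S₀` for `ν_j = ∑_{M_j ≤ k ≤ N} n_k`, where
`M = M_j`, and `M₁` and `u₁` are the first stratification point and the first node. -/
def nuHat (C p : ℝ) (a : ℕ → ℝ) (δ u₁ : ℝ) (M₁ M : ℕ) {N : ℕ} (η : Nat.Partition N) : ℝ :=
  √(fZero C (p - 1) u₁) * ((young η (M : ℝ) - sumAbove a δ N M) / √(sumBelow a δ M₁))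

/-- The random vector `(ν̂₁, …, ν̂_q)` for the stratification points `M_j = rd (u_j r_N)`, where
`rd : ℝ → ℕ` is a rounding function. -/
def nuHatVec (C p : ℝ) (a : ℕ → ℝ) (δ : ℝ) (rd : ℝ → ℕ) {q : ℕ} [NeZero q] (u : Fin q → ℝ)
    {N : ℕ} (η : Nat.Partition N) : EuclideanSpace ℝ (Fin q) :=
  WithLp.toLp 2 fun j => nuHat C p a δ (u 0)
    (rd (u 0 * scaling C p N)) (rd (u j * scaling C p N)) η

/-- The fluctuation `Δ(u) = ν̃(u) - l(u)` of `η` from the curve `l(u) = Γ(p, u) / Γ(p+1)`. -/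
def fluctuation (C p : ℝ) {N : ℕ} (η : Nat.Partition N) (u : ℝ) : ℝ :=
  scaledYoung (scaling C p N) η u - limitCurve p u

/-- `(C Γ(p+1) N / r_N)^{1/2}`. -/
def fluctuationFactor (C p : ℝ) (N : ℕ) : ℝ :=
  √(C * Real.Gamma (p + 1) * (N : ℝ) * (scaling C p N)⁻¹)

end

end GibbsPartition

open GibbsPartition

/-!
A Gibbs random partition is a Poisson sample conditioned on its size. Let `Zₖ` be independent
Poisson variables of means `λₖ = aₖ e^{-δ k}`, `1 ≤ k ≤ N`. The factor `e^{-δ k}` contributes the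
constant `e^{-δ N}` to the weight of every partition of `N`, so `μ_N` is the law of `(Zₖ)` given
`∑ k Zₖ = N`, and the equation for `δ_N` says that the constraint sits at the mean.

Fourier inversion in the variable `t` dual to the constraint makes this quantitative
(`gibbs_charFun_eq`): for every choice of coefficients `s`, the characteristic functional
`E exp (i ∑ sₖ (nₖ - λₖ))` under `μ_N` is the quotient of `∫ Ψ(s, t) dt` by `∫ Ψ(0, t) dt` over
`[-π, π]`, where `Ψ(s, t) = exp (∑ λₖ (e^{i xₖ} - 1 - i xₖ))` and `xₖ = sₖ + k t`. Both centrings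
together remove the linear terms.

On the scale `sₖ = r^{-p/2} g(k)`, `t = θ r^{-p/2-1}`, where `g` has the scaling limit `G`, the
exponent is a Riemann sum on the mesh `1/r` and converges to `-½ ∫ w(x) (G(x) + θ x)² dx` with
`w(x) = C x^{p-1} e^{-x}` (`tendsto_sum_weights`, which also yields `δ_N r_N → 1`). The integrand in
`θ` is dominated because `∑ λₖ (1 - cos k t) ≥ c r^p min(1, (r t)²)` on the whole circle
(`exists_le_sum_weights_one_sub_cos`). Completing the square in `θ` leaves
`exp (-½ (∫ w G² - (∫ w x G)² / ∫ w x²))`, a Gaussian characteristic function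
(`TiltRegime.tendsto_gibbs_charFun`).

For `G = ∑ ξⱼ 1_{[uⱼ, ∞)}` the variance is the quadratic form of the matrix `e`, which is therefore
positive semidefinite, and Lévy's theorem gives the central limit theorem. The relation to the
fluctuations is an identity, combined with the limits of `r^{-p} Sⱼ` and `r^{-p} S₀`. For the limit
shape, the coefficients `r^{-p} ξ 1_{k ≥ u r}` have profile `G = 0`, so that `ν̃(u) → l(u)` in
probability at each `u ≥ 0`, zero included; since `ν̃` and `l` are nonincreasing and `l` is
continuous, finitely many points control the supremum over `[0, b]`.
-/

namespace GibbsPartition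

/-! ### Partitions, power series and Fourier inversion -/

open PowerSeries in
/-- The power series `exp (b X ^ k) = ∑ⱼ bʲ X ^ (k j) / j!`, for `k ≠ 0`. -/
noncomputable def expSeries (b : ℂ) (k : ℕ) : PowerSeries ℂ :=
  PowerSeries.mk fun n => if k ∣ n then b ^ (n / k) / ((n / k).factorial : ℂ) else 0

open PowerSeries PowerSeries.WithPiTopology in
lemma hasSum_expSeries (b : ℂ) {k : ℕ} (hk : k ≠ 0) :
    HasSum (fun j : ℕ => (b ^ j / (j.factorial : ℂ)) • (X : PowerSeries ℂ) ^ (k * j))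
      (expSeries b k) := by
  rw [hasSum_iff_hasSum_coeff]
  intro n
  simp only [expSeries, coeff_mk, map_smul, coeff_X_pow, smul_eq_mul, mul_ite, mul_one, mul_zero]
  split_ifs with h
  · obtain ⟨m, rfl⟩ := h
    rw [Nat.mul_div_cancel_left _ (Nat.pos_of_ne_zero hk)]
    have := hasSum_single (f := fun j => if k * m = k * j then b ^ j / (j.factorial : ℂ) else 0) m
      (fun j hj => if_neg (by simpa [hk] using fun h => hj h.symm))
    simpa using this
  · convert! hasSum_zero with j
    rw [if_neg]
    rintro rfl
    exact h ⟨j, rfl⟩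

open PowerSeries PowerSeries.WithPiTopology in
/-- The weighted sum over the partitions of `N` is a coefficient of a product of exponential
series. -/
lemma sum_partition_eq_coeff (b : ℕ → ℂ) (N : ℕ) :
    ∑ η : Nat.Partition N, ∏ k ∈ Finset.Icc 1 N, b k ^ mult η k / ((mult η k).factorial : ℂ) =
      coeff N (∏ k ∈ Finset.Icc 1 N, expSeries (b k) k) := by
  set f : ℕ → ℕ → ℂ := fun i c => if i ≤ N then b i ^ c / (c.factorial : ℂ) else 0 with hf
  have h1 := Nat.Partition.hasProd_genFun f
  have h2 : ∀ i < N, (1 : PowerSeries ℂ) + ∑' j, f (i + 1) (j + 1) • X ^ ((i + 1) * (j + 1)) =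
      expSeries (b (i + 1)) (i + 1) := by
    intro i hi
    have hs := hasSum_expSeries (b (i + 1)) (Nat.succ_ne_zero i)
    have h3 := (hasSum_nat_add_iff' 1).2 hs
    simp only [hf, if_pos (Nat.succ_le_of_lt hi)]
    rw [h3.tsum_eq]
    simp
  have h3 : ∀ i ∉ Finset.range N,
      (1 : PowerSeries ℂ) + ∑' j, f (i + 1) (j + 1) • X ^ ((i + 1) * (j + 1)) = 1 := by
    intro i hi
    have : ¬ i + 1 ≤ N := by simpa using hi
    simp [hf, this]
  have h4 := (hasProd_prod_of_ne_finset_one h3).unique h1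
  have h5 : ∏ k ∈ Finset.Icc 1 N, expSeries (b k) k = Nat.Partition.genFun f := by
    rw [← h4, Finset.prod_congr rfl (fun i hi => h2 i (Finset.mem_range.1 hi)),
      ← Finset.Ico_succ_right_eq_Icc, Finset.prod_Ico_eq_prod_range]
    simp [add_comm]
  rw [h5, Nat.Partition.coeff_genFun]
  refine Finset.sum_congr rfl fun η _ => ?_
  rw [Finsupp.prod, Multiset.toFinsupp_support]
  symm
  have hmem : ∀ i ∈ η.parts, i ≤ N := fun i hi => by
    have := Multiset.le_sum_of_mem hi
    rwa [η.parts_sum] at this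
  calc _ = ∏ k ∈ η.parts.toFinset, b k ^ mult η k / ((mult η k).factorial : ℂ) := by
        refine Finset.prod_congr rfl fun i hi => ?_
        simp [hf, hmem i (Multiset.mem_toFinset.1 hi), mult]
    _ = _ := by
        refine Finset.prod_subset (fun i hi => ?_) fun i _ hi => ?_
        · have := Multiset.mem_toFinset.1 hi
          exact Finset.mem_Icc.2 ⟨η.parts_pos this, hmem i this⟩
        · have : mult η i = 0 := Multiset.count_eq_zero.2 (fun h => hi (Multiset.mem_toFinset.2 h))
          simp [this]

/-- The function `f` is the sum on the unit circle of the power series `P`, which converges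
absolutely there. -/
structure SumsOnCircle (P : PowerSeries ℂ) (f : ℂ → ℂ) : Prop where
  summable : Summable fun n => ‖PowerSeries.coeff n P‖
  tsum_eq : ∀ z : ℂ, ‖z‖ = 1 → ∑' n, PowerSeries.coeff n P * z ^ n = f z

lemma SumsOnCircle.one : SumsOnCircle 1 1 := by
  constructor
  · refine summable_of_ne_finset_zero (s := {0}) fun n hn => ?_
    simp_all [PowerSeries.coeff_one]
  · intro z _
    rw [tsum_eq_single 0]
    · simp
    · intro n hn
      simp [PowerSeries.coeff_one, hn]

lemma SumsOnCircle.mul {P Q : PowerSeries ℂ} {f g : ℂ → ℂ} (hP : SumsOnCircle P f)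
    (hQ : SumsOnCircle Q g) : SumsOnCircle (P * Q) (f * g) := by
  constructor
  · have h := summable_norm_sum_mul_antidiagonal_of_summable_norm
      (f := fun n => PowerSeries.coeff n P) (g := fun n => PowerSeries.coeff n Q)
      hP.summable hQ.summable
    refine h.congr fun n => ?_
    rw [PowerSeries.coeff_mul]
  · intro z hz
    have h1 : Summable fun n => ‖PowerSeries.coeff n P * z ^ n‖ := by
      simpa only [norm_mul, norm_pow, hz, one_pow, mul_one] using hP.summable
    have h2 : Summable fun n => ‖PowerSeries.coeff n Q * z ^ n‖ := by
      simpa only [norm_mul, norm_pow, hz, one_pow, mul_one] using hQ.summable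
    rw [Pi.mul_apply, ← hP.tsum_eq z hz, ← hQ.tsum_eq z hz,
      tsum_mul_tsum_eq_tsum_sum_antidiagonal_of_summable_norm h1 h2]
    refine tsum_congr fun n => ?_
    rw [PowerSeries.coeff_mul, Finset.sum_mul]
    refine Finset.sum_congr rfl fun kl hkl => ?_
    rw [← Finset.HasAntidiagonal.mem_antidiagonal.1 hkl, pow_add]
    ring

lemma sumsOnCircle_expSeries (b : ℂ) {k : ℕ} (hk : k ≠ 0) :
    SumsOnCircle (expSeries b k) fun z => Complex.exp (b * z ^ k) := by
  have hinj : Function.Injective fun j : ℕ => k * j := mul_right_injective₀ hk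
  have hsupp : ∀ n ∉ Set.range (fun j : ℕ => k * j),
      PowerSeries.coeff n (expSeries b k) = 0 := by
    intro n hn
    simp only [expSeries, PowerSeries.coeff_mk]
    rw [if_neg]
    rintro ⟨j, rfl⟩
    exact hn ⟨j, rfl⟩
  have hcoeff : ∀ j, PowerSeries.coeff (k * j) (expSeries b k) =
      b ^ j / (j.factorial : ℂ) := by
    intro j
    simp [expSeries, Nat.mul_div_cancel_left _ (Nat.pos_of_ne_zero hk)]
  constructor
  · rw [← hinj.summable_iff fun n hn => by rw [hsupp n hn, norm_zero]]
    simp only [Function.comp_def, hcoeff]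
    exact (NormedSpace.norm_expSeries_div_summable (𝔸 := ℂ) b)
  · intro z _
    rw [← hinj.tsum_eq (f := fun n => PowerSeries.coeff n (expSeries b k) * z ^ n)]
    · simp only [hcoeff]
      rw [Complex.exp_eq_exp_ℂ, NormedSpace.exp_eq_tsum_div]
      refine tsum_congr fun j => ?_
      rw [mul_pow, pow_mul]
      ring
    · intro n hn
      by_contra h
      exact hn (by simp [hsupp n h])

lemma SumsOnCircle.prod {s : Finset ℕ} {P : ℕ → PowerSeries ℂ} {f : ℕ → ℂ → ℂ}
    (h : ∀ k ∈ s, SumsOnCircle (P k) (f k)) : SumsOnCircle (∏ k ∈ s, P k) (∏ k ∈ s, f k) := by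
  induction s using Finset.cons_induction with
  | empty => simpa using SumsOnCircle.one
  | cons k s hk ih =>
    rw [Finset.prod_cons, Finset.prod_cons]
    exact (h k (Finset.mem_cons_self k s)).mul (ih fun j hj => h j (Finset.mem_cons_of_mem hj))

lemma integral_exp_int_mul_I (m : ℤ) :
    ∫ t in -Real.pi..Real.pi, Complex.exp (m * t * Complex.I) =
      if m = 0 then 2 * (Real.pi : ℂ) else 0 := by
  split_ifs with h
  · subst h
    simp
    ring
  · have hc : (m : ℂ) * Complex.I ≠ 0 := mul_ne_zero (by exact_mod_cast h) Complex.I_ne_zero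
    have h1 := integral_exp_mul_complex (a := -Real.pi) (b := Real.pi) hc
    have h2 : Complex.exp (m * Complex.I * (Real.pi : ℝ)) =
        Complex.exp (m * Complex.I * ((-Real.pi : ℝ) : ℂ)) := by
      rw [Complex.exp_eq_exp_iff_exists_int]
      exact ⟨m, by push_cast; ring⟩
    rw [h2, sub_self, zero_div] at h1
    rw [← h1]
    refine intervalIntegral.integral_congr fun t _ => ?_
    congr 1
    ring

/-- Fourier inversion: a coefficient of an absolutely convergent power series is an integral
over the unit circle. -/
lemma SumsOnCircle.integral_eq {P : PowerSeries ℂ} {f : ℂ → ℂ} (h : SumsOnCircle P f) (m : ℕ) :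
    ∫ t in -Real.pi..Real.pi, f (Complex.exp (t * Complex.I)) *
      Complex.exp (-(m * t * Complex.I)) = 2 * Real.pi * PowerSeries.coeff m P := by
  set F : ℕ → C(ℝ, ℂ) := fun n => ⟨fun t : ℝ => PowerSeries.coeff n P *
    Complex.exp (((n : ℤ) - (m : ℤ) : ℤ) * t * Complex.I), by fun_prop⟩ with hF
  have hnorm : ∀ (x : ℤ) (t : ℝ), ‖Complex.exp (x * t * Complex.I)‖ = 1 := by
    intro x t
    have := Complex.norm_exp_ofReal_mul_I (x * t)
    push_cast at this
    exact this
  have hsum : Summable fun n =>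
      ‖(F n).restrict (⟨Set.uIcc (-Real.pi) Real.pi, isCompact_uIcc⟩ :
        TopologicalSpace.Compacts ℝ)‖ := by
    refine Summable.of_nonneg_of_le (fun n => norm_nonneg _) (fun n => ?_) h.summable
    refine (ContinuousMap.norm_le _ (norm_nonneg _)).2 fun t => ?_
    simp only [hF, ContinuousMap.restrict_apply, ContinuousMap.coe_mk, norm_mul, hnorm, mul_one,
      le_refl]
  have h1 := intervalIntegral.hasSum_intervalIntegral_of_summable_norm (a := -Real.pi)
    (b := Real.pi) hsum
  have h2 : ∀ t : ℝ, ∑' n, F n t = f (Complex.exp (t * Complex.I)) *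
      Complex.exp (-(m * t * Complex.I)) := by
    intro t
    rw [← h.tsum_eq _ (Complex.norm_exp_ofReal_mul_I t), ← tsum_mul_right]
    refine tsum_congr fun n => ?_
    simp only [hF, ContinuousMap.coe_mk]
    rw [← Complex.exp_nat_mul, mul_assoc (PowerSeries.coeff n P), ← Complex.exp_add]
    congr 2
    push_cast
    ring
  simp only [h2] at h1
  refine h1.unique ?_
  have h3 : ∀ n, ∫ t in -Real.pi..Real.pi, F n t =
      if n = m then 2 * Real.pi * PowerSeries.coeff m P else 0 := by
    intro n
    simp only [hF, ContinuousMap.coe_mk]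
    rw [intervalIntegral.integral_const_mul, integral_exp_int_mul_I]
    by_cases hnm : n = m
    · simp [hnm, mul_comm]
    · have : ((n : ℤ) - m) ≠ 0 := by omega
      simp [hnm, this]
  simp only [h3]
  exact hasSum_ite_eq m _

/-- The Fourier representation of a multiplicative functional of a random partition. -/
lemma sum_partition_eq_integral (b : ℕ → ℂ) (N : ℕ) :
    2 * Real.pi * ∑ η : Nat.Partition N,
        ∏ k ∈ Finset.Icc 1 N, b k ^ mult η k / ((mult η k).factorial : ℂ) =
      ∫ t in -Real.pi..Real.pi,
        Complex.exp (∑ k ∈ Finset.Icc 1 N, b k * Complex.exp (k * t * Complex.I) -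
          N * t * Complex.I) := by
  have h := SumsOnCircle.prod (s := Finset.Icc 1 N) (P := fun k => expSeries (b k) k)
    (f := fun k z => Complex.exp (b k * z ^ k))
    fun k hk => sumsOnCircle_expSeries (b k) (by have := (Finset.mem_Icc.1 hk).1; omega)
  rw [sum_partition_eq_coeff, ← h.integral_eq N]
  refine intervalIntegral.integral_congr fun t _ => ?_
  simp only [Finset.prod_apply]
  rw [← Complex.exp_sum, ← Complex.exp_add, sub_eq_add_neg]
  congr 2
  refine Finset.sum_congr rfl fun k _ => ?_
  rw [← Complex.exp_nat_mul]
  ring_nf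

/-! ### Riemann sums against the tilted weights -/

lemma exists_one_add_pow_mul_exp_le (m : ℕ) {c : ℝ} (hc : 0 < c) :
    ∃ K : ℝ, 0 ≤ K ∧ ∀ y : ℝ, 0 ≤ y → (1 + y) ^ m * Real.exp (-(c * y)) ≤ K := by
  set M : ℝ := max 1 ((m + 1) / c) with hM
  have hM0 : 0 ≤ M := le_trans zero_le_one (le_max_left _ _)
  refine ⟨M ^ m, pow_nonneg hM0 m, fun y hy => ?_⟩
  have hm : (0 : ℝ) < m + 1 := by positivity
  have h1 : 1 + y ≤ M * Real.exp (c * y / (m + 1)) := by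
    calc 1 + y ≤ M * 1 + M * (c * y / (m + 1)) := by
          have h2 : (m + 1) / c * (c * y / (m + 1)) = y := by field_simp
          have h3 : (m + 1) / c * (c * y / (m + 1)) ≤ M * (c * y / (m + 1)) := by
            gcongr
            exact le_max_right _ _
          have h4 : 1 ≤ M := le_max_left _ _
          linarith
      _ = M * (c * y / (m + 1) + 1) := by ring
      _ ≤ _ := by gcongr; exact Real.add_one_le_exp _
  calc (1 + y) ^ m * Real.exp (-(c * y))
      ≤ (M * Real.exp (c * y / (m + 1))) ^ m * Real.exp (-(c * y)) := by gcongr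
    _ = M ^ m * Real.exp (m * (c * y / (m + 1)) - c * y) := by
        rw [mul_pow, ← Real.exp_nat_mul, mul_assoc, ← Real.exp_add]
        ring_nf
    _ ≤ M ^ m * 1 := by
        gcongr
        rw [Real.exp_le_one_iff]
        have : m * (c * y / (m + 1)) - c * y = -(c * y / (m + 1)) := by field_simp; ring
        rw [this, neg_nonpos]
        positivity
    _ = M ^ m := mul_one _

/-- A bound of the summands in a Riemann sum by an integrable function of the left end point. -/
lemma exists_rpow_mul_exp_le {p β : ℝ} (hβ : 0 < β) :
    ∃ K : ℝ, 0 ≤ K ∧ ∀ x y : ℝ, 0 < x → x ≤ y →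
      y ^ (p - 1) * (1 + y) ^ 2 * Real.exp (-(β * y)) ≤
        K * (x ^ (min p 1 - 1) * Real.exp (-(β / 2 * x))) := by
  set m : ℕ := ⌈p - min p 1⌉₊ with hm
  obtain ⟨K, hK, h⟩ := exists_one_add_pow_mul_exp_le (m + 2) (half_pos hβ)
  refine ⟨K, hK, fun x y hx hxy => ?_⟩
  have hy : 0 < y := hx.trans_le hxy
  have h0 : 0 ≤ p - min p 1 := sub_nonneg.2 (min_le_left _ _)
  have h1 : y ^ (p - 1) = y ^ (p - min p 1) * y ^ (min p 1 - 1) := by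
    rw [← Real.rpow_add hy]; ring_nf
  have h2 : y ^ (p - min p 1) ≤ (1 + y) ^ m := by
    calc y ^ (p - min p 1) ≤ (1 + y) ^ (p - min p 1) := by
          gcongr; linarith
      _ ≤ (1 + y) ^ (m : ℝ) := Real.rpow_le_rpow_of_exponent_le (by linarith) (Nat.le_ceil _)
      _ = _ := Real.rpow_natCast _ _
  have h3 : y ^ (min p 1 - 1) ≤ x ^ (min p 1 - 1) :=
    Real.rpow_le_rpow_of_nonpos hx hxy (sub_nonpos.2 (min_le_right _ _))
  have h4 : Real.exp (-(β / 2 * y)) ≤ Real.exp (-(β / 2 * x)) := by gcongr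
  calc y ^ (p - 1) * (1 + y) ^ 2 * Real.exp (-(β * y))
      = y ^ (p - min p 1) * y ^ (min p 1 - 1) * (1 + y) ^ 2 *
          (Real.exp (-(β / 2 * y)) * Real.exp (-(β / 2 * y))) := by
        rw [h1, ← Real.exp_add]; ring_nf
    _ ≤ (1 + y) ^ m * x ^ (min p 1 - 1) * (1 + y) ^ 2 *
          (Real.exp (-(β / 2 * y)) * Real.exp (-(β / 2 * x))) := by gcongr
    _ = ((1 + y) ^ (m + 2) * Real.exp (-(β / 2 * y))) *
          (x ^ (min p 1 - 1) * Real.exp (-(β / 2 * x))) := by ring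
    _ ≤ _ := by
        gcongr
        exact h y hy.le

lemma preimage_ceil_eq {r : ℝ} (hr : 0 < r) {k : ℕ} (hk : 1 ≤ k) :
    {x : ℝ | ⌈r * x⌉₊ = k} = Set.Ioc (((k : ℝ) - 1) / r) (k / r) := by
  ext x
  have : ((k - 1 : ℕ) : ℝ) = k - 1 := by push_cast [hk]; ring
  rw [Set.mem_ofPred_eq, Nat.ceil_eq_iff (by omega), Set.mem_Ioc, this, div_lt_iff₀ hr,
    le_div_iff₀ hr, mul_comm r]

/-- The step function on `(0, ∞)` whose integral is the Riemann sum of `h` with mesh `1 / r`: its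
value at `x` is `h ⌈r x⌉`, cut off beyond `⌈r x⌉ = N`. -/
noncomputable def riemannStep {E : Type*} [AddCommMonoid E] (r : ℝ) (N : ℕ) (h : ℕ → E) (x : ℝ) :
    E :=
  ∑ k ∈ Finset.Icc 1 N, {x : ℝ | ⌈r * x⌉₊ = k}.indicator (fun _ => h k) x

lemma riemannStep_eq {E : Type*} [AddCommMonoid E] (r : ℝ) (N : ℕ) (h : ℕ → E) (x : ℝ) :
    riemannStep r N h x = if ⌈r * x⌉₊ ∈ Finset.Icc 1 N then h ⌈r * x⌉₊ else 0 := by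
  simp [riemannStep, Set.indicator_apply]

section RiemannSum

variable {E : Type*} [NormedAddCommGroup E]

lemma integrable_riemannStep {r : ℝ} (hr : 0 < r) (N : ℕ) (h : ℕ → E) :
    Integrable (riemannStep r N h) := by
  refine integrable_finsetSum _ fun k hk => ?_
  rw [preimage_ceil_eq hr (Finset.mem_Icc.1 hk).1]
  exact (integrableOn_const measure_Ioc_lt_top.ne).integrable_indicator measurableSet_Ioc

variable [NormedSpace ℝ E]

lemma integral_riemannStep [CompleteSpace E] {r : ℝ} (hr : 0 < r) (N : ℕ) (h : ℕ → E) :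
    ∫ x in Set.Ioi 0, riemannStep r N h x = r⁻¹ • ∑ k ∈ Finset.Icc 1 N, h k := by
  simp only [riemannStep]
  rw [integral_finsetSum, Finset.smul_sum]
  · refine Finset.sum_congr rfl fun k hk => ?_
    have hk1 := (Finset.mem_Icc.1 hk).1
    have hk1' : (1 : ℝ) ≤ k := by exact_mod_cast hk1
    rw [preimage_ceil_eq hr hk1, setIntegral_indicator measurableSet_Ioc,
      Set.inter_eq_self_of_subset_right, setIntegral_const, measureReal_def, Real.volume_Ioc,
      ENNReal.toReal_ofReal]
    · congr 1
      field_simp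
      ring
    · rw [← sub_div]
      simp [hr.le]
    · intro x hx
      exact lt_of_le_of_lt (div_nonneg (by linarith) hr.le) hx.1
  · intro k hk
    rw [preimage_ceil_eq hr (Finset.mem_Icc.1 hk).1]
    exact ((integrableOn_const measure_Ioc_lt_top.ne).integrable_indicator
      measurableSet_Ioc).integrableOn

lemma tendsto_ceil_mul_div {r : ℕ → ℝ} (hr : Tendsto r atTop atTop) {x : ℝ} (hx : 0 ≤ x) :
    Tendsto (fun N => (⌈r N * x⌉₊ : ℝ) / r N) atTop (𝓝 x) := by
  simpa [mul_comm, Function.comp_def] using (tendsto_nat_ceil_mul_div_atTop hx).comp hr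

lemma tendsto_ceil_mul_atTop {r : ℕ → ℝ} (hr : Tendsto r atTop atTop) {x : ℝ} (hx : 0 < x) :
    Tendsto (fun N => ⌈r N * x⌉₊) atTop atTop :=
  tendsto_nat_ceil_atTop.comp (hr.atTop_mul_const hx)

lemma exists_le_mul_rpow {C p : ℝ} {a : ℕ → ℝ}
    (hasymp : (fun k : ℕ => a k) ~[atTop] fun k : ℕ => C * (k : ℝ) ^ (p - 1)) :
    ∃ A : ℝ, 0 ≤ A ∧ ∀ k : ℕ, 1 ≤ k → |a k| ≤ A * (k : ℝ) ^ (p - 1) := by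
  have h1 : (fun k : ℕ => a k) =O[atTop] fun k : ℕ => (k : ℝ) ^ (p - 1) :=
    hasymp.isBigO.trans (isBigO_const_mul_self C _ _)
  obtain ⟨c, hc⟩ := h1.bound
  obtain ⟨n, hn⟩ := eventually_atTop.1 hc
  -- The sum takes care of the finitely many `k` before the asymptotic bound holds.
  set A := |c| + ∑ k ∈ Finset.range n, |a k| / (k : ℝ) ^ (p - 1) with hA
  have hsum : ∀ k, 0 ≤ |a k| / (k : ℝ) ^ (p - 1) := fun k => by positivity
  refine ⟨A, add_nonneg (abs_nonneg _) (Finset.sum_nonneg fun k _ => hsum k), fun k hk => ?_⟩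
  have hk0 : (0 : ℝ) < k := by exact_mod_cast hk
  have hkp : 0 < (k : ℝ) ^ (p - 1) := Real.rpow_pos_of_pos hk0 _
  rcases le_or_gt n k with h | h
  · have := hn k h
    rw [Real.norm_eq_abs, Real.norm_eq_abs, abs_of_pos hkp] at this
    refine this.trans ?_
    gcongr
    exact (le_abs_self c).trans (le_add_of_nonneg_right (Finset.sum_nonneg fun k _ => hsum k))
  · rw [← div_le_iff₀ hkp]
    have := Finset.single_le_sum (f := fun k => |a k| / (k : ℝ) ^ (p - 1)) (fun k _ => hsum k)
      (Finset.mem_range.2 h)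
    exact this.trans (le_add_of_nonneg_left (abs_nonneg _))

lemma tendsto_div_rpow {C p : ℝ} {a : ℕ → ℝ}
    (hasymp : (fun k : ℕ => a k) ~[atTop] fun k : ℕ => C * (k : ℝ) ^ (p - 1)) :
    Tendsto (fun k : ℕ => a k / (k : ℝ) ^ (p - 1)) atTop (𝓝 C) := by
  obtain ⟨φ, hφ, h⟩ := hasymp.exists_eq_mul
  have h1 : Tendsto (fun k => φ k * C) atTop (𝓝 C) := by simpa using hφ.mul_const C
  refine h1.congr' ?_
  filter_upwards [h, eventually_ge_atTop 1] with k hk hk1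
  have hk0 : (0 : ℝ) < k := by exact_mod_cast hk1
  have hkp : 0 < (k : ℝ) ^ (p - 1) := Real.rpow_pos_of_pos hk0 _
  rw [hk]
  simp only [Pi.mul_apply]
  field_simp

/-- **Riemann sums against the tilted weights.** If `a k ∼ C k ^ (p - 1)` and the scale `r`
satisfies `d r → β`, then sums against the weights `a k * exp (-d k)`, normalised by `r ^ (-p)`,
converge to integrals against `C x ^ (p - 1) e ^ (-β x)`. Dominated convergence for the step
functions covers the integrable singularity at zero and the tail at once. -/
theorem tendsto_sum_weights [CompleteSpace E] {C p : ℝ} (hp : 0 < p) {a : ℕ → ℝ}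
    (hasymp : (fun k : ℕ => a k) ~[atTop] fun k : ℕ => C * (k : ℝ) ^ (p - 1))
    {r d : ℕ → ℝ} {β : ℝ} (hβ : 0 < β) (hr : Tendsto r atTop atTop)
    (hrN : Tendsto (fun N : ℕ => (N : ℝ) / r N) atTop atTop)
    (hd : Tendsto (fun N => d N * r N) atTop (𝓝 β))
    {φ : ℕ → ℕ → E} {Φ : ℝ → E} {K : ℝ}
    (hbound : ∀ᶠ N in atTop, ∀ k : ℕ, 1 ≤ k → ‖φ N k‖ ≤ K * (1 + k / r N) ^ 2)
    (hlim : ∀ᵐ x ∂volume.restrict (Set.Ioi (0 : ℝ)),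
      Tendsto (fun N => φ N ⌈r N * x⌉₊) atTop (𝓝 (Φ x))) :
    Tendsto (fun N => (r N ^ p)⁻¹ •
        ∑ k ∈ Finset.Icc 1 N, (a k * Real.exp (-d N * k)) • φ N k) atTop
      (𝓝 (∫ x in Set.Ioi (0 : ℝ), (C * (x ^ (p - 1) * Real.exp (-(β * x)))) • Φ x)) := by
  obtain ⟨A, hA, hAa⟩ := exists_le_mul_rpow hasymp
  obtain ⟨L, hL, hLb⟩ := exists_rpow_mul_exp_le (p := p) (half_pos hβ)
  set h : ℕ → ℕ → E := fun N k => (r N ^ (1 - p) * (a k * Real.exp (-d N * k))) • φ N k with hh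
  have heq : ∀ᶠ N in atTop, ∫ x in Set.Ioi 0, riemannStep (r N) N (h N) x =
      (r N ^ p)⁻¹ • ∑ k ∈ Finset.Icc 1 N, (a k * Real.exp (-d N * k)) • φ N k := by
    filter_upwards [hr.eventually_gt_atTop 0] with N hN
    rw [integral_riemannStep hN]
    simp only [hh, mul_smul, ← Finset.smul_sum]
    rw [smul_smul]
    congr 1
    rw [Real.rpow_sub hN, Real.rpow_one]
    field_simp
  refine Tendsto.congr' heq ?_
  refine tendsto_integral_filter_of_dominated_convergence
    (fun x => A * |K| * (L * (x ^ (min p 1 - 1) * Real.exp (-(β / 2 / 2 * x))))) ?_ ?_ ?_ ?_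
  · filter_upwards [hr.eventually_gt_atTop 0] with N hN
    exact (integrable_riemannStep hN _ _).aestronglyMeasurable.restrict
  · filter_upwards [hr.eventually_gt_atTop 0, hbound,
      hd.eventually_const_le (half_lt_self hβ)] with N hN hb hdN
    filter_upwards [ae_restrict_mem measurableSet_Ioi] with x hx
    have hx : 0 < x := hx
    rw [riemannStep_eq]
    split_ifs with hk
    · set k := ⌈r N * x⌉₊ with hkdef
      have hk1 : 1 ≤ k := (Finset.mem_Icc.1 hk).1
      have hk0 : (0 : ℝ) < k := by exact_mod_cast hk1
      set y : ℝ := k / r N with hy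
      have hky : (k : ℝ) = r N * y := by rw [hy]; field_simp
      have hxy : x ≤ y := by
        rw [hy, le_div_iff₀ hN, mul_comm]
        exact Nat.le_ceil _
      have hy0 : 0 < y := hx.trans_le hxy
      have hnorm : ‖h N k‖ = r N ^ (1 - p) * (|a k| * Real.exp (-d N * k)) * ‖φ N k‖ := by
        simp only [hh, norm_smul, norm_mul, Real.norm_eq_abs, Real.abs_exp]
        rw [abs_of_pos (Real.rpow_pos_of_pos hN _)]
      have hexp : Real.exp (-d N * k) ≤ Real.exp (-(β / 2 * y)) := by
        rw [hky]
        gcongr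
        have : β / 2 * y ≤ d N * r N * y := by gcongr
        linarith
      calc ‖h N k‖ = r N ^ (1 - p) * (|a k| * Real.exp (-d N * k)) * ‖φ N k‖ := hnorm
        _ ≤ r N ^ (1 - p) * (A * (k : ℝ) ^ (p - 1) * Real.exp (-(β / 2 * y))) *
            (|K| * (1 + y) ^ 2) := by
          gcongr
          · exact hAa k hk1
          · exact (hb k hk1).trans (by gcongr; exact le_abs_self K)
        _ = A * |K| * (y ^ (p - 1) * (1 + y) ^ 2 * Real.exp (-(β / 2 * y))) := by
          have : r N ^ (1 - p) * (k : ℝ) ^ (p - 1) = y ^ (p - 1) := by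
            rw [hky, Real.mul_rpow hN.le hy0.le, ← mul_assoc, ← Real.rpow_add hN]
            simp
          rw [← this]
          ring
        _ ≤ _ := by
          exact mul_le_mul_of_nonneg_left (hLb x y hx hxy) (by positivity)
    · rw [norm_zero]
      positivity
  · refine Integrable.const_mul (Integrable.const_mul ?_ _) _
    have := integrableOn_rpow_mul_exp_neg_mul_rpow (p := 1) (s := min p 1 - 1) (b := β / 2 / 2)
      (by have := lt_min hp one_pos; linarith) one_pos (by positivity)
    simpa [IntegrableOn] using this
  · filter_upwards [ae_restrict_mem measurableSet_Ioi, hlim] with x hx hφ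
    have hx : 0 < x := hx
    have hk := tendsto_ceil_mul_div hr hx.le
    have hkN : ∀ᶠ N in atTop, ⌈r N * x⌉₊ ∈ Finset.Icc 1 N := by
      filter_upwards [(tendsto_ceil_mul_atTop hr hx).eventually_ge_atTop 1,
        hk.eventually_lt_const (lt_add_one x), hrN.eventually_ge_atTop (x + 1),
        hr.eventually_gt_atTop 0] with N h1 h2 h3 h4
      refine Finset.mem_Icc.2 ⟨h1, ?_⟩
      have := (h2.trans_le h3).le
      rw [div_le_div_iff_of_pos_right h4] at this
      exact_mod_cast this
    have h1 := (tendsto_div_rpow hasymp).comp (tendsto_ceil_mul_atTop hr hx)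
    have h2 : Tendsto (fun N => ((⌈r N * x⌉₊ : ℝ) / r N) ^ (p - 1)) atTop (𝓝 (x ^ (p - 1))) :=
      hk.rpow_const (Or.inl hx.ne')
    have h3 : Tendsto (fun N => Real.exp (-(d N * r N * ((⌈r N * x⌉₊ : ℝ) / r N)))) atTop
        (𝓝 (Real.exp (-(β * x)))) := (Real.continuous_exp.tendsto _).comp (hd.mul hk).neg
    refine Tendsto.congr' ?_ ((h1.mul (h2.mul h3)).smul hφ)
    filter_upwards [hkN, hr.eventually_gt_atTop 0] with N hkN hN
    rw [riemannStep_eq, if_pos hkN]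
    simp only [hh]
    congr 1
    have hk0 : (0 : ℝ) < (⌈r N * x⌉₊ : ℝ) := by exact_mod_cast (Finset.mem_Icc.1 hkN).1
    simp only [Function.comp_apply]
    set y : ℝ := (⌈r N * x⌉₊ : ℝ)
    have e1 : -(d N * r N * (y / r N)) = -d N * y := by field_simp
    have e2 : r N ^ (1 - p) = (r N ^ (p - 1))⁻¹ := by
      rw [← Real.rpow_neg hN.le]; ring_nf
    have : 0 < y ^ (p - 1) := Real.rpow_pos_of_pos hk0 _
    rw [e1, e2, Real.div_rpow hk0.le hN.le]
    field_simp

end RiemannSum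

/-! ### The scaling, the tilting parameter and the minor arcs -/

lemma scaling_pos {C p : ℝ} (hC : 0 < C) (hp : 0 < p) {N : ℕ} (hN : 1 ≤ N) :
    0 < scaling C p N := by
  have hN' : (0 : ℝ) < N := by exact_mod_cast hN
  have := Real.Gamma_pos_of_pos (show 0 < p + 1 by linarith)
  unfold scaling
  positivity

lemma scaling_rpow {C p : ℝ} (hC : 0 < C) (hp : 0 < p) (N : ℕ) :
    C * Real.Gamma (p + 1) * scaling C p N ^ (p + 1) = N := by
  have hG := Real.Gamma_pos_of_pos (show 0 < p + 1 by linarith)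
  have hp1 : p + 1 ≠ 0 := by linarith
  unfold scaling
  rw [Real.mul_rpow (by positivity) (by positivity), Real.inv_rpow (by positivity),
    ← Real.rpow_mul (by positivity), ← Real.rpow_mul (by positivity), one_div,
    inv_mul_cancel₀ hp1, Real.rpow_one, Real.rpow_one, mul_inv_cancel_left₀ (by positivity)]

lemma tendsto_scaling {C p : ℝ} (hC : 0 < C) (hp : 0 < p) :
    Tendsto (scaling C p) atTop atTop := by
  have hG := Real.Gamma_pos_of_pos (show 0 < p + 1 by linarith)
  refine Tendsto.const_mul_atTop (by positivity) ?_
  exact (tendsto_rpow_atTop (by positivity)).comp tendsto_natCast_atTop_atTop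

lemma tendsto_div_scaling {C p : ℝ} (hC : 0 < C) (hp : 0 < p) :
    Tendsto (fun N : ℕ => (N : ℝ) / scaling C p N) atTop atTop := by
  have hG := Real.Gamma_pos_of_pos (show 0 < p + 1 by linarith)
  have h : Tendsto (fun N => C * Real.Gamma (p + 1) * scaling C p N ^ p) atTop atTop :=
    Tendsto.const_mul_atTop (by positivity)
      ((tendsto_rpow_atTop hp).comp (tendsto_scaling hC hp))
  refine h.congr' ?_
  filter_upwards [eventually_ge_atTop 1] with N hN
  have hr := scaling_pos hC hp hN
  rw [eq_div_iff hr.ne', mul_assoc, ← Real.rpow_add_one hr.ne', scaling_rpow hC hp]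

lemma integral_weight_mul {C p β : ℝ} (hp : 0 < p) (hβ : 0 < β) :
    ∫ x in Set.Ioi (0 : ℝ), (C * (x ^ (p - 1) * Real.exp (-(β * x)))) • x =
      C * ((1 / β) ^ (p + 1) * Real.Gamma (p + 1)) := by
  rw [← Real.integral_rpow_mul_exp_neg_mul_Ioi (by linarith) hβ, ← integral_const_mul]
  refine setIntegral_congr_fun measurableSet_Ioi fun x hx => ?_
  have hx : 0 < x := hx
  have : x ^ (p + 1 - 1) = x ^ (p - 1) * x := by rw [← Real.rpow_add_one hx.ne']; ring_nf
  simp only [this, smul_eq_mul]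
  ring

section Tilt

variable {C p : ℝ} {a : ℕ → ℝ}

lemma tendsto_mean_tilt (hC : 0 < C) (hp : 0 < p)
    (hasymp : (fun k : ℕ => a k) ~[atTop] fun k : ℕ => C * (k : ℝ) ^ (p - 1))
    {β : ℝ} (hβ : 0 < β) :
    Tendsto (fun N : ℕ => (∑ k ∈ Finset.Icc 1 N,
      (k : ℝ) * a k * Real.exp (-(β / scaling C p N) * k)) / N) atTop
      (𝓝 ((1 / β) ^ (p + 1))) := by
  have hG := Real.Gamma_pos_of_pos (show 0 < p + 1 by linarith)
  have hr := tendsto_scaling hC hp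
  have h := tendsto_sum_weights (E := ℝ) hp hasymp hβ hr (tendsto_div_scaling hC hp)
    (d := fun N => β / scaling C p N) (φ := fun N k => (k : ℝ) / scaling C p N) (Φ := fun x => x)
    (K := 1) ?_ ?_ ?_
  · rw [integral_weight_mul hp hβ] at h
    have h2 := h.const_mul (C * Real.Gamma (p + 1))⁻¹
    have e : (C * Real.Gamma (p + 1))⁻¹ * (C * ((1 / β) ^ (p + 1) * Real.Gamma (p + 1))) =
        (1 / β) ^ (p + 1) := by field_simp
    rw [e] at h2
    refine h2.congr' ?_
    filter_upwards [eventually_ge_atTop 1] with N hN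
    have hrN := scaling_pos hC hp hN
    have hN' := scaling_rpow hC hp N
    rw [Real.rpow_add_one hrN.ne'] at hN'
    have hinv : (N : ℝ)⁻¹ =
        (C * Real.Gamma (p + 1))⁻¹ * ((scaling C p N ^ p)⁻¹ * (scaling C p N)⁻¹) := by
      rw [← hN', mul_inv _ (_ * _), mul_inv (_ ^ _)]
    rw [div_eq_mul_inv _ (N : ℝ), hinv]
    simp only [smul_eq_mul, Finset.mul_sum, Finset.sum_mul]
    refine Finset.sum_congr rfl fun k _ => ?_
    ring
  · refine tendsto_const_nhds.congr' ?_
    filter_upwards [eventually_ge_atTop 1] with N hN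
    have hrN := scaling_pos hC hp hN
    field_simp
  · filter_upwards [eventually_ge_atTop 1] with N hN k _
    have hrN := scaling_pos hC hp hN
    have : 0 ≤ (k : ℝ) / scaling C p N := by positivity
    rw [Real.norm_eq_abs, abs_of_nonneg this]
    nlinarith
  · filter_upwards [ae_restrict_mem measurableSet_Ioi] with x hx
    exact tendsto_ceil_mul_div hr (le_of_lt hx)

/-- The tilting parameter satisfies `δ_N ∼ 1 / r_N`, since the tilted mean is decreasing in the
parameter and its limit at the parameter `β / r_N` is `β ^ (-(p + 1)) N`. -/
theorem tendsto_tilt_mul_scaling (hC : 0 < C) (hp : 0 < p) (ha : ∀ k, 1 ≤ k → 0 < a k)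
    (hasymp : (fun k : ℕ => a k) ~[atTop] fun k : ℕ => C * (k : ℝ) ^ (p - 1))
    {δ : ℕ → ℝ} (hδ : ∀ N : ℕ, 1 ≤ N →
      ∑ k ∈ Finset.Icc 1 N, (k : ℝ) * a k * Real.exp (-δ N * k) = (N : ℝ)) :
    Tendsto (fun N => δ N * scaling C p N) atTop (𝓝 1) := by
  have hmono : ∀ (N : ℕ) (x y : ℝ), x ≤ y →
      ∑ k ∈ Finset.Icc 1 N, (k : ℝ) * a k * Real.exp (-y * k) ≤
        ∑ k ∈ Finset.Icc 1 N, (k : ℝ) * a k * Real.exp (-x * k) := by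
    intro N x y hxy
    refine Finset.sum_le_sum fun k hk => ?_
    have := ha k (Finset.mem_Icc.1 hk).1
    gcongr
  refine tendsto_order.2 ⟨fun b hb => ?_, fun b hb => ?_⟩
  · set β := max b (1 / 2) with hβ
    have hβ0 : 0 < β := lt_of_lt_of_le (by norm_num) (le_max_right _ _)
    have hβ1 : β < 1 := max_lt hb (by norm_num)
    have h1 : 1 < (1 / β) ^ (p + 1) :=
      Real.one_lt_rpow ((one_lt_div hβ0).2 hβ1) (by linarith)
    filter_upwards [(tendsto_mean_tilt hC hp hasymp hβ0).eventually_const_lt h1,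
      eventually_ge_atTop 1] with N h2 hN
    have hrN := scaling_pos hC hp hN
    have hN' : (0 : ℝ) < N := by exact_mod_cast hN
    rw [one_lt_div hN'] at h2
    by_contra hcon
    push Not at hcon
    have := hmono N (δ N) (β / scaling C p N)
      ((le_div_iff₀ hrN).2 (hcon.trans (le_max_left _ _)))
    rw [hδ N hN] at this
    linarith
  · have hβ0 : 0 < b := one_pos.trans hb
    have h1 : (1 / b) ^ (p + 1) < 1 :=
      Real.rpow_lt_one (by positivity) ((div_lt_one hβ0).2 hb) (by linarith)
    filter_upwards [(tendsto_mean_tilt hC hp hasymp hβ0).eventually_lt_const h1,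
      eventually_ge_atTop 1] with N h2 hN
    have hrN := scaling_pos hC hp hN
    have hN' : (0 : ℝ) < N := by exact_mod_cast hN
    rw [div_lt_one hN'] at h2
    by_contra hcon
    push Not at hcon
    have := hmono N (b / scaling C p N) (δ N) ((div_le_iff₀ hrN).2 hcon)
    rw [hδ N hN] at this
    linarith

end Tilt

lemma sum_cos_mul_two_sin (t : ℝ) (m n : ℕ) :
    (∑ k ∈ Finset.range n, Real.cos ((m + k : ℕ) * t)) * (2 * Real.sin (t / 2)) =
      Real.sin ((m + n - 1 / 2) * t) - Real.sin ((m - 1 / 2) * t) := by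
  have h := Finset.sum_range_sub (fun k : ℕ => Real.sin ((m + k - 1 / 2) * t)) n
  simp only [Nat.cast_zero, add_zero] at h
  rw [← h, Finset.sum_mul]
  refine Finset.sum_congr rfl fun k _ => ?_
  have e1 : ((m : ℝ) + (k + 1 : ℕ) - 1 / 2) * t = (m + k : ℕ) * t + t / 2 := by push_cast; ring
  have e2 : ((m : ℝ) + k - 1 / 2) * t = (m + k : ℕ) * t - t / 2 := by push_cast; ring
  rw [e1, e2, Real.sin_add, Real.sin_sub]
  ring

lemma sum_cos_le {t : ℝ} (ht : t ≠ 0) (htπ : |t| ≤ Real.pi) (m n : ℕ) :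
    ∑ k ∈ Finset.range n, Real.cos ((m + k : ℕ) * t) ≤ Real.pi / |t| := by
  have ht0 : 0 < |t| := abs_pos.2 ht
  have h1 : |t| / Real.pi ≤ |Real.sin (t / 2)| := by
    have h := Real.mul_le_sin (x := |t| / 2) (by positivity) (by linarith)
    have e : 2 / Real.pi * (|t| / 2) = |t| / Real.pi := by ring
    rw [e] at h
    refine h.trans ?_
    rcases abs_choice t with h' | h' <;> rw [h']
    · exact le_abs_self _
    · rw [neg_div, Real.sin_neg]; exact neg_le_abs _
  have h2 := congrArg abs (sum_cos_mul_two_sin t m n)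
  rw [abs_mul, abs_mul, abs_two] at h2
  have h3 : |Real.sin ((m + n - 1 / 2) * t) - Real.sin ((m - 1 / 2) * t)| ≤ 2 := by
    refine (abs_sub _ _).trans ?_
    linarith [Real.abs_sin_le_one ((m + n - 1 / 2) * t), Real.abs_sin_le_one ((m - 1 / 2) * t)]
  set S := ∑ k ∈ Finset.range n, Real.cos ((m + k : ℕ) * t)
  have h4 : |S| * (|t| / Real.pi) ≤ 1 := by
    have := mul_le_mul_of_nonneg_left h1 (abs_nonneg S)
    linarith
  refine (le_abs_self S).trans ?_
  rw [le_div_iff₀ ht0]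
  have := Real.pi_pos
  rw [← mul_div_assoc, div_le_one this] at h4
  exact h4

/-- Away from zero the terms `1 - cos (k t)` average out over the block `[m, 9 m)`, and for
`|t| ≤ 1 / m` they are quadratic there. -/
lemma le_sum_one_sub_cos {t : ℝ} (htπ : |t| ≤ Real.pi) {m : ℕ} (hm : 1 ≤ m) :
    (m : ℝ) / 5 * min 1 ((m * t) ^ 2) ≤
      ∑ k ∈ Finset.range (8 * m), (1 - Real.cos ((m + k : ℕ) * t)) := by
  have hm0 : (0 : ℝ) < m := by exact_mod_cast hm
  have hπ : Real.pi < 3.15 := Real.pi_lt_d2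
  rcases le_or_gt |t| (1 / m) with h | h
  · have hmt : |t| * m ≤ 1 := (le_div_iff₀ hm0).1 h
    calc (m : ℝ) / 5 * min 1 ((m * t) ^ 2) ≤ m / 5 * (m * t) ^ 2 := by
          gcongr; exact min_le_right _ _
      _ = ∑ k ∈ Finset.range m, 1 / 5 * (m * t) ^ 2 := by
          rw [Finset.sum_const, Finset.card_range, nsmul_eq_mul]; ring
      _ ≤ ∑ k ∈ Finset.range m, (1 - Real.cos ((m + k : ℕ) * t)) := by
          refine Finset.sum_le_sum fun k hk => ?_
          have hk' : (k : ℝ) ≤ m := by exact_mod_cast (Finset.mem_range.1 hk).le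
          have hle : |((m + k : ℕ) : ℝ) * t| ≤ Real.pi := by
            rw [abs_mul, Nat.abs_cast]
            push_cast
            have : (m + k : ℝ) * |t| ≤ (m + m) * |t| := by gcongr
            linarith [Real.pi_gt_three]
          have h1 := Real.cos_le_one_sub_mul_cos_sq hle
          have h2 : (1 : ℝ) / 5 ≤ 2 / Real.pi ^ 2 := by
            rw [div_le_div_iff₀ (by norm_num) (by positivity)]
            nlinarith [Real.pi_pos]
          have h3 : (m * t) ^ 2 ≤ (((m + k : ℕ) : ℝ) * t) ^ 2 := by
            rw [mul_pow, mul_pow]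
            push_cast
            gcongr
            linarith [(Nat.cast_nonneg k : (0 : ℝ) ≤ k)]
          have h4 := mul_le_mul h2 h3 (sq_nonneg _) (by positivity)
          linarith
      _ ≤ _ := by
          refine Finset.sum_le_sum_of_subset_of_nonneg ?_ fun k _ _ => ?_
          · exact Finset.range_subset_range.2 (by omega)
          · linarith [Real.cos_le_one ((m + k : ℕ) * t)]
  · have ht0 : t ≠ 0 := by
      rintro rfl
      rw [abs_zero] at h
      exact absurd h (not_lt.2 (by positivity))
    have h1 := sum_cos_le ht0 htπ m (8 * m)
    have h2 : Real.pi / |t| ≤ Real.pi * m := by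
      rw [div_le_iff₀ (abs_pos.2 ht0), mul_assoc]
      have : 1 ≤ m * |t| := by
        rw [div_lt_iff₀ hm0] at h; linarith
      nlinarith [Real.pi_pos]
    rw [Finset.sum_sub_distrib, Finset.sum_const, Finset.card_range, nsmul_eq_mul]
    have h3 : (m : ℝ) / 5 * min 1 ((m * t) ^ 2) ≤ m / 5 * 1 := by
      gcongr; exact min_le_left _ _
    have h4 : Real.pi * m ≤ 3.15 * m := by gcongr
    rw [Nat.cast_mul, Nat.cast_ofNat]
    linarith

/-- The lower bound behind the local limit theorem: it controls the modulus of the characteristic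
function of the tilted sum on the whole circle, near zero by a Gaussian. -/
theorem exists_le_sum_weights_one_sub_cos {C p : ℝ} (hC : 0 < C) {a : ℕ → ℝ}
    (ha : ∀ k, 1 ≤ k → 0 < a k)
    (hasymp : (fun k : ℕ => a k) ~[atTop] fun k : ℕ => C * (k : ℝ) ^ (p - 1))
    (hp : 0 < p) {r d : ℕ → ℝ} (hr : Tendsto r atTop atTop)
    (hrN : Tendsto (fun N : ℕ => (N : ℝ) / r N) atTop atTop)
    (hd : Tendsto (fun N => d N * r N) atTop (𝓝 1)) :
    ∃ c : ℝ, 0 < c ∧ ∀ᶠ N in atTop, ∀ t : ℝ, |t| ≤ Real.pi →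
      c * r N ^ p * min 1 ((r N * t) ^ 2) ≤
        ∑ k ∈ Finset.Icc 1 N, a k * Real.exp (-d N * k) * (1 - Real.cos (k * t)) := by
  set c₀ : ℝ := C / 2 * (1 / 18) * Real.exp (-36) with hc₀
  have hc₀pos : 0 < c₀ := by positivity
  obtain ⟨k₀, hk₀⟩ := eventually_atTop.1
    ((tendsto_div_rpow hasymp).eventually_const_le (half_lt_self hC))
  refine ⟨c₀ / 5, by positivity, ?_⟩
  filter_upwards [hr.eventually_ge_atTop 1, hr.eventually_ge_atTop k₀,
    hrN.eventually_ge_atTop 18, hd.eventually_le_const (show (1 : ℝ) < 2 by norm_num)] with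
    N hr1 hrk hN18 hd2 t ht
  have hr0 : 0 < r N := one_pos.trans_le hr1
  set m : ℕ := ⌈r N⌉₊ with hm
  have hrm : r N ≤ m := Nat.le_ceil _
  have hm1 : 1 ≤ m := by exact_mod_cast hr1.trans hrm
  have hm2 : (m : ℝ) ≤ 2 * r N := by
    have := (Nat.ceil_lt_add_one hr0.le).le
    linarith
  rw [le_div_iff₀ hr0] at hN18
  -- On the block `[m, 9 m)` the ratio `y = k / r` lies in `[1, 18]`, and `d r ≤ 2`.
  have hlower : ∀ k ∈ Finset.range (8 * m),
      c₀ * r N ^ (p - 1) ≤ a (m + k) * Real.exp (-d N * (m + k : ℕ)) := by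
    intro k hk
    have hk' : (k : ℝ) + 1 ≤ 8 * m := by
      exact_mod_cast Nat.succ_le_of_lt (Finset.mem_range.1 hk)
    set y : ℝ := ((m + k : ℕ) : ℝ) / r N with hy
    have hky : ((m + k : ℕ) : ℝ) = r N * y := by rw [hy]; field_simp
    have hy1 : 1 ≤ y := by
      rw [hy, one_le_div hr0]
      push_cast
      linarith [(Nat.cast_nonneg k : (0 : ℝ) ≤ k)]
    have hy18 : y ≤ 18 := by
      rw [hy, div_le_iff₀ hr0]
      push_cast
      linarith
    have hy0 : 0 < y := one_pos.trans_le hy1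
    have hkk : k₀ ≤ m + k := by
      have : (k₀ : ℝ) ≤ m := hrk.trans hrm
      have : k₀ ≤ m := by exact_mod_cast this
      omega
    have h1 := hk₀ _ hkk
    rw [le_div_iff₀ (Real.rpow_pos_of_pos (by rw [hky]; positivity) _), hky,
      Real.mul_rpow hr0.le hy0.le] at h1
    have h2 : 1 / 18 ≤ y ^ (p - 1) := by
      calc (1 : ℝ) / 18 ≤ 1 / y := by gcongr
        _ = y ^ (-1 : ℝ) := by rw [Real.rpow_neg_one, one_div]
        _ ≤ _ := Real.rpow_le_rpow_of_exponent_le hy1 (by linarith)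
    have h3 : Real.exp (-36) ≤ Real.exp (-d N * (m + k : ℕ)) := by
      rw [hky]
      gcongr
      have : d N * r N * y ≤ 2 * y := by gcongr
      linarith
    calc c₀ * r N ^ (p - 1) = C / 2 * (r N ^ (p - 1) * (1 / 18)) * Real.exp (-36) := by
          rw [hc₀]; ring
      _ ≤ C / 2 * (r N ^ (p - 1) * y ^ (p - 1)) * Real.exp (-d N * (m + k : ℕ)) := by gcongr
      _ ≤ _ := by gcongr
  have hnn : ∀ k : ℕ, 0 ≤ 1 - Real.cos (k * t) := fun k => by
    linarith [Real.cos_le_one (k * t)]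
  have hrp : r N ^ p = r N ^ (p - 1) * r N := by
    rw [← Real.rpow_add_one hr0.ne']; ring_nf
  calc c₀ / 5 * r N ^ p * min 1 ((r N * t) ^ 2)
      = c₀ * r N ^ (p - 1) * (r N / 5 * min 1 ((r N * t) ^ 2)) := by rw [hrp]; ring
    _ ≤ c₀ * r N ^ (p - 1) * (m / 5 * min 1 ((m * t) ^ 2)) := by
        rw [mul_pow, mul_pow]; gcongr
    _ ≤ c₀ * r N ^ (p - 1) * ∑ k ∈ Finset.range (8 * m), (1 - Real.cos ((m + k : ℕ) * t)) := by
        gcongr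
        exact le_sum_one_sub_cos ht hm1
    _ ≤ ∑ k ∈ Finset.range (8 * m),
          a (m + k) * Real.exp (-d N * (m + k : ℕ)) * (1 - Real.cos ((m + k : ℕ) * t)) := by
        rw [Finset.mul_sum]
        exact Finset.sum_le_sum fun k hk => mul_le_mul_of_nonneg_right (hlower k hk) (hnn _)
    _ = ∑ k ∈ Finset.Ico m (m + 8 * m),
          a k * Real.exp (-d N * k) * (1 - Real.cos (k * t)) := by
        rw [Finset.sum_Ico_eq_sum_range, Nat.add_sub_cancel_left]
    _ ≤ _ := by
        refine Finset.sum_le_sum_of_subset_of_nonneg (fun k hk => ?_) fun k hk _ => ?_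
        · have hk' := Finset.mem_Ico.1 hk
          have : ((9 * m : ℕ) : ℝ) ≤ N := by push_cast; linarith
          have : 9 * m ≤ N := by exact_mod_cast this
          exact Finset.mem_Icc.2 ⟨by omega, by omega⟩
        · have := ha k (Finset.mem_Icc.1 hk).1
          exact mul_nonneg (by positivity) (hnn k)

lemma half_one_sub_cos_le (x y : ℝ) :
    (1 - Real.cos x) / 2 - (1 - Real.cos y) ≤ 1 - Real.cos (x + y) := by
  have h : ∀ z : ℝ, 1 - Real.cos z = 2 * Real.sin (z / 2) ^ 2 := fun z => by
    have := Real.cos_sq' (z / 2)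
    have h2 := Real.cos_two_mul (z / 2)
    rw [mul_div_cancel₀ z two_ne_zero] at h2
    linarith
  have e : x / 2 = (x + y) / 2 - y / 2 := by ring
  rw [h, h, h, e, Real.sin_sub]
  set A := (x + y) / 2
  set B := y / 2
  nlinarith [sq_nonneg (Real.sin A * Real.cos B + Real.cos A * Real.sin B),
    Real.sin_sq_add_cos_sq A, Real.sin_sq_add_cos_sq B, sq_nonneg (Real.sin A * Real.sin B),
    mul_nonneg (sq_nonneg (Real.sin A)) (sq_nonneg (Real.sin B))]

/-! ### Conditioning the Poisson model -/

/-- The remainder `e^{ix} - 1 - ix`, the exponent of the characteristic function of a centred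
Poisson variable of mean one. -/
noncomputable def expRem (x : ℝ) : ℂ := Complex.exp (x * Complex.I) - 1 - x * Complex.I

lemma continuous_expRem : Continuous expRem := by
  unfold expRem
  fun_prop

lemma re_expRem (x : ℝ) : (expRem x).re = -(1 - Real.cos x) := by
  simp [expRem, Complex.exp_ofReal_mul_I_re]

lemma norm_expRem_add_sq_le {x : ℝ} (hx : |x| ≤ 1) : ‖expRem x + x ^ 2 / 2‖ ≤ |x| ^ 3 := by
  have hn : ‖(x : ℂ) * Complex.I‖ = |x| := by simp
  have h := Complex.exp_bound (x := x * Complex.I) (by rwa [hn]) (n := 3) (by norm_num)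
  rw [hn] at h
  have e : Complex.exp (x * Complex.I) -
      ∑ m ∈ Finset.range 3, ((x : ℂ) * Complex.I) ^ m / (m.factorial : ℂ) =
      expRem x + x ^ 2 / 2 := by
    simp only [expRem, Finset.sum_range_succ, Finset.sum_range_zero, mul_pow, Complex.I_sq]
    norm_num [Nat.factorial]
    ring
  rw [e] at h
  refine h.trans ?_
  have : 0 ≤ |x| ^ 3 := by positivity
  norm_num [Nat.factorial]
  nlinarith

lemma norm_expRem_le (x : ℝ) : ‖expRem x‖ ≤ 3 * x ^ 2 := by
  rcases le_or_gt |x| 1 with h | h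
  · have hn : ‖(x : ℂ) * Complex.I‖ = |x| := by simp
    have := Complex.norm_exp_sub_one_sub_id_le (x := x * Complex.I) (by rwa [hn])
    rw [hn, sq_abs] at this
    have h2 : 0 ≤ x ^ 2 := sq_nonneg x
    exact this.trans (by linarith)
  · have h1 : ‖expRem x‖ ≤ 1 + 1 + |x| := by
      refine (norm_sub_le _ _).trans (add_le_add ((norm_sub_le _ _).trans ?_) ?_)
      · rw [Complex.norm_exp_ofReal_mul_I, norm_one]
      · simp
    rw [← sq_abs]
    nlinarith

lemma tendsto_sq_mul_expRem {ρ y : ℕ → ℝ} {z : ℝ} (hρ : Tendsto ρ atTop atTop)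
    (hy : Tendsto y atTop (𝓝 z)) :
    Tendsto (fun N => ((ρ N ^ 2 : ℝ) : ℂ) * expRem ((ρ N)⁻¹ * y N)) atTop
      (𝓝 (-(z ^ 2 / 2 : ℝ))) := by
  have hinv : Tendsto (fun N => (ρ N)⁻¹) atTop (𝓝 0) := hρ.inv_tendsto_atTop
  have h0 : Tendsto (fun N => (ρ N)⁻¹ * y N) atTop (𝓝 0) := by simpa using hinv.mul hy
  have h1 : Tendsto (fun N => ((ρ N ^ 2 : ℝ) : ℂ) * (expRem ((ρ N)⁻¹ * y N) +
      (((ρ N)⁻¹ * y N : ℝ) : ℂ) ^ 2 / 2)) atTop (𝓝 0) := by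
    have hlim : Tendsto (fun N => (ρ N)⁻¹ * |y N| ^ 3) atTop (𝓝 0) := by
      simpa using hinv.mul (hy.abs.pow 3)
    refine squeeze_zero_norm' ?_ hlim
    have habs : Tendsto (fun N => |(ρ N)⁻¹ * y N|) atTop (𝓝 0) := by simpa using h0.abs
    filter_upwards [habs.eventually_le_const one_pos, hρ.eventually_gt_atTop 0] with N hN hρN
    have := norm_expRem_add_sq_le hN
    rw [norm_mul, Complex.norm_real, Real.norm_eq_abs, abs_of_pos (by positivity)]
    refine (mul_le_mul_of_nonneg_left this (by positivity)).trans (le_of_eq ?_)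
    rw [abs_mul, abs_of_pos (inv_pos.2 hρN)]
    field_simp
  have h2 : Tendsto (fun N => -((y N ^ 2 / 2 : ℝ) : ℂ)) atTop (𝓝 (-(z ^ 2 / 2 : ℝ))) :=
    ((Complex.continuous_ofReal.tendsto _).comp ((hy.pow 2).div_const 2)).neg
  have h3 := h1.add h2
  rw [zero_add] at h3
  refine h3.congr' ?_
  filter_upwards [hρ.eventually_gt_atTop 0] with N hρN
  have : (ρ N : ℂ) ≠ 0 := by exact_mod_cast hρN.ne'
  push_cast
  field_simp
  ring

/-- The characteristic function, at `(s, t)`, of the centred independent Poisson variables `Zₖ` of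
means `w k`, tested against `s k + k t`: here `t` is the variable dual to `∑ k Zₖ`. -/
noncomputable def poissonChar (w : ℕ → ℝ) (N : ℕ) (s : ℕ → ℝ) (t : ℝ) : ℂ :=
  Complex.exp (∑ k ∈ Finset.Icc 1 N, w k * expRem (s k + k * t))

lemma continuous_poissonChar (w : ℕ → ℝ) (N : ℕ) (s : ℕ → ℝ) : Continuous (poissonChar w N s) := by
  unfold poissonChar
  have := continuous_expRem
  fun_prop

lemma norm_poissonChar (w : ℕ → ℝ) (N : ℕ) (s : ℕ → ℝ) (t : ℝ) :
    ‖poissonChar w N s t‖ =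
      Real.exp (-∑ k ∈ Finset.Icc 1 N, w k * (1 - Real.cos (s k + k * t))) := by
  rw [poissonChar, Complex.norm_exp, Complex.re_sum, ← Finset.sum_neg_distrib]
  congr 1
  refine Finset.sum_congr rfl fun k _ => ?_
  rw [Complex.re_ofReal_mul, re_expRem]
  ring

lemma sum_mul_mult {N : ℕ} (η : Nat.Partition N) :
    ∑ k ∈ Finset.Icc 1 N, k * mult η k = N := by
  have hsub : η.parts.toFinset ⊆ Finset.Icc 1 N := fun i hi => by
    have hi' := Multiset.mem_toFinset.1 hi
    have := Multiset.le_sum_of_mem hi'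
    rw [η.parts_sum] at this
    exact Finset.mem_Icc.2 ⟨η.parts_pos hi', this⟩
  conv_rhs => rw [← η.parts_sum, Finset.sum_multiset_count_of_subset _ _ hsub]
  refine Finset.sum_congr rfl fun k _ => ?_
  rw [smul_eq_mul, mul_comm, mult]

/-- **Conditioning.** The characteristic functional of the Gibbs measure, as an integral of the
characteristic function of the tilted Poisson variables over the variable dual to the
constraint `∑ k nₖ = N`. -/
lemma sum_weight_mul_exp (a : ℕ → ℝ) (d : ℝ) (N : ℕ)
    (hd : ∑ k ∈ Finset.Icc 1 N, (k : ℝ) * a k * Real.exp (-d * k) = (N : ℝ)) (s : ℕ → ℝ) :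
    2 * Real.pi * Complex.exp (-d * N - ∑ k ∈ Finset.Icc 1 N, (a k * Real.exp (-d * k) : ℝ)) *
        ∑ η : Nat.Partition N, (weight a η : ℂ) * Complex.exp
          ((∑ k ∈ Finset.Icc 1 N, s k * (mult η k - a k * Real.exp (-d * k)) : ℝ) * Complex.I) =
      ∫ t in -Real.pi..Real.pi, poissonChar (fun k => a k * Real.exp (-d * k)) N s t := by
  set w : ℕ → ℝ := fun k => a k * Real.exp (-d * k) with hw
  have h := sum_partition_eq_integral (fun k => w k * Complex.exp (s k * Complex.I)) N
  set c : ℂ := Complex.exp (-∑ k ∈ Finset.Icc 1 N, ((w k : ℂ) + s k * w k * Complex.I)) with hc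
  have h1 : ∀ t : ℝ, poissonChar w N s t = c *
      Complex.exp (∑ k ∈ Finset.Icc 1 N,
        (w k * Complex.exp (s k * Complex.I)) * Complex.exp (k * t * Complex.I) -
          N * t * Complex.I) := by
    intro t
    rw [hc, ← Complex.exp_add, poissonChar]
    congr 1
    have hN : (N : ℂ) = ∑ k ∈ Finset.Icc 1 N, (k : ℂ) * w k := by
      have : (N : ℝ) = ∑ k ∈ Finset.Icc 1 N, (k : ℝ) * w k := by
        rw [← hd]
        exact Finset.sum_congr rfl fun k _ => by rw [hw]; ring
      exact_mod_cast congrArg (fun x : ℝ => (x : ℂ)) this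
    rw [mul_assoc (N : ℂ)]
    conv_rhs => rw [hN]
    rw [Finset.sum_mul, ← Finset.sum_sub_distrib, ← Finset.sum_neg_distrib,
      ← Finset.sum_add_distrib]
    refine Finset.sum_congr rfl fun k _ => ?_
    rw [mul_assoc (w k : ℂ), ← Complex.exp_add, expRem]
    have : ((s k + k * t : ℝ) : ℂ) * Complex.I = s k * Complex.I + k * t * Complex.I := by
      push_cast; ring
    rw [this]
    ring
  have h2 : ∀ η : Nat.Partition N, ∏ k ∈ Finset.Icc 1 N,
      (w k * Complex.exp (s k * Complex.I)) ^ mult η k / ((mult η k).factorial : ℂ) =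
      Complex.exp (-d * N) * (weight a η *
        Complex.exp (∑ k ∈ Finset.Icc 1 N, s k * mult η k * Complex.I)) := by
    intro η
    have hN : (N : ℂ) = ∑ k ∈ Finset.Icc 1 N, (k : ℂ) * mult η k := by
      exact_mod_cast congrArg (fun x : ℕ => (x : ℂ)) (sum_mul_mult η).symm
    conv_rhs => rw [hN]
    rw [weight, Complex.ofReal_prod, Complex.exp_sum, Finset.mul_sum, Complex.exp_sum,
      ← Finset.prod_mul_distrib, ← Finset.prod_mul_distrib]
    refine Finset.prod_congr rfl fun k _ => ?_
    rw [hw]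
    push_cast
    rw [mul_pow, mul_pow, ← Complex.exp_nat_mul, ← Complex.exp_nat_mul]
    ring_nf
  simp_rw [h1]
  rw [intervalIntegral.integral_const_mul, ← h, Finset.sum_congr rfl fun η _ => h2 η,
    ← Finset.mul_sum]
  have h3 : ∀ η : Nat.Partition N, (weight a η : ℂ) * Complex.exp
      ((∑ k ∈ Finset.Icc 1 N, s k * (mult η k - w k) : ℝ) * Complex.I) =
      Complex.exp (-∑ k ∈ Finset.Icc 1 N, (s k * w k * Complex.I)) * (weight a η *
        Complex.exp (∑ k ∈ Finset.Icc 1 N, s k * mult η k * Complex.I)) := by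
    intro η
    rw [mul_left_comm, ← Complex.exp_add]
    congr 2
    push_cast
    rw [Finset.sum_mul, ← Finset.sum_neg_distrib, ← Finset.sum_add_distrib]
    exact Finset.sum_congr rfl fun k _ => by ring
  rw [Finset.sum_congr rfl fun η _ => h3 η, ← Finset.mul_sum]
  have h4 : Complex.exp (-d * N - (∑ k ∈ Finset.Icc 1 N, w k : ℝ)) *
      Complex.exp (-∑ k ∈ Finset.Icc 1 N, (s k * w k * Complex.I)) = c * Complex.exp (-d * N) := by
    rw [hc, ← Complex.exp_add, ← Complex.exp_add]
    congr 1
    rw [Finset.sum_add_distrib, Complex.ofReal_sum]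
    ring
  linear_combination (2 * Real.pi * ∑ η : Nat.Partition N, (weight a η : ℂ) *
        Complex.exp (∑ k ∈ Finset.Icc 1 N, s k * mult η k * Complex.I)) * h4

/-- The characteristic functional of the Gibbs measure as a quotient of two integrals. -/
lemma gibbs_charFun_eq {a : ℕ → ℝ} (ha : ∀ k, 1 ≤ k → 0 < a k) {d : ℝ} {N : ℕ}
    (hd : ∑ k ∈ Finset.Icc 1 N, (k : ℝ) * a k * Real.exp (-d * k) = (N : ℝ)) (s : ℕ → ℝ) :
    ∫ η, Complex.exp ((∑ k ∈ Finset.Icc 1 N,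
        s k * (mult η k - a k * Real.exp (-d * k)) : ℝ) * Complex.I)
        ∂(gibbs a ha N).toMeasure =
      (∫ t in -Real.pi..Real.pi, poissonChar (fun k => a k * Real.exp (-d * k)) N s t) /
      ∫ t in -Real.pi..Real.pi, poissonChar (fun k => a k * Real.exp (-d * k)) N 0 t := by
  have hZ := partitionFunction_pos ha N
  have hZ' : (partitionFunction a N : ℂ) ≠ 0 := by exact_mod_cast hZ.ne'
  rw [← sum_weight_mul_exp a d N hd, ← sum_weight_mul_exp a d N hd, PMF.integral_eq_sum]
  have h0 : ∑ η : Nat.Partition N, (weight a η : ℂ) * Complex.exp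
      ((∑ k ∈ Finset.Icc 1 N, (0 : ℕ → ℝ) k * (mult η k - a k * Real.exp (-d * k)) : ℝ) *
        Complex.I) = partitionFunction a N := by
    simp [partitionFunction]
  have h1 : (2 * Real.pi * Complex.exp
      (-d * N - ∑ k ∈ Finset.Icc 1 N, (a k * Real.exp (-d * k) : ℝ)) : ℂ) ≠ 0 :=
    mul_ne_zero (mul_ne_zero two_ne_zero (by exact_mod_cast Real.pi_ne_zero))
      (Complex.exp_ne_zero _)
  rw [h0, mul_div_mul_left _ _ h1, Finset.sum_div]
  refine Finset.sum_congr rfl fun η _ => ?_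
  have hw := weight_pos ha η
  rw [gibbs, PMF.ofFintype_apply, ENNReal.toReal_ofReal (by positivity), Complex.real_smul]
  push_cast
  ring

/-! ### The conditional central limit theorem -/

/-- The density `C x ^ (p - 1) e ^ (-x)` of the limiting profile of the tilted weights. -/
noncomputable def limitDensity (C p x : ℝ) : ℝ := C * (x ^ (p - 1) * Real.exp (-x))

lemma limitDensity_nonneg {C p x : ℝ} (hC : 0 < C) (hx : 0 < x) : 0 ≤ limitDensity C p x := by
  unfold limitDensity
  positivity

lemma integrable_limitDensity_mul_rpow (C : ℝ) {p s : ℝ} (hs : 0 < p + s) :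
    IntegrableOn (fun x => limitDensity C p x * x ^ s) (Set.Ioi 0) := by
  have h := (Real.GammaIntegral_convergent hs).const_mul C
  refine IntegrableOn.congr_fun h (fun x hx => ?_) measurableSet_Ioi
  have hx : 0 < x := hx
  have : x ^ (p + s - 1) = x ^ (p - 1) * x ^ s := by rw [← Real.rpow_add hx]; ring_nf
  simp only [limitDensity, this]
  ring

lemma integrable_limitDensity_mul_pow (C : ℝ) {p : ℝ} (hp : 0 < p) (n : ℕ) :
    IntegrableOn (fun x => limitDensity C p x * x ^ n) (Set.Ioi 0) := by
  simpa using integrable_limitDensity_mul_rpow C (s := n) (by positivity : 0 < p + (n : ℝ))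

/-- A bounded measurable function on the half line, the scaling limit of a linear statistic. -/
structure BoundedProfile (G : ℝ → ℝ) : Prop where
  measurable : Measurable G
  bounded : ∃ K, ∀ x, |G x| ≤ K

lemma BoundedProfile.integrable {G : ℝ → ℝ} (hG : BoundedProfile G) (C : ℝ) {p : ℝ} (hp : 0 < p)
    (n : ℕ) : IntegrableOn (fun x => limitDensity C p x * x ^ n * G x) (Set.Ioi 0) := by
  obtain ⟨K, hK⟩ := hG.bounded
  exact (integrable_limitDensity_mul_pow C hp n).mul_bdd hG.measurable.aestronglyMeasurable
    (c := K) (Eventually.of_forall hK)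

lemma BoundedProfile.mul {G H : ℝ → ℝ} (hG : BoundedProfile G) (hH : BoundedProfile H) :
    BoundedProfile fun x => G x * H x := by
  obtain ⟨K, hK⟩ := hG.bounded
  obtain ⟨L, hL⟩ := hH.bounded
  refine ⟨hG.measurable.mul hH.measurable, K * L, fun x => ?_⟩
  rw [abs_mul]
  exact mul_le_mul (hK x) (hL x) (abs_nonneg _) ((abs_nonneg _).trans (hK x))

/-- The limiting variance of a linear statistic with profile `G`, conditioned on the total size:
the variance `∫ w G²` of the Poisson model, minus the squared covariance with the total size over
the variance of the total size. -/
noncomputable def condVariance (C p : ℝ) (G : ℝ → ℝ) : ℝ :=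
  (∫ x in Set.Ioi 0, limitDensity C p x * (G x * G x)) -
    (∫ x in Set.Ioi 0, limitDensity C p x * x * G x) ^ 2 /
      ∫ x in Set.Ioi 0, limitDensity C p x * x ^ 2

lemma integral_limitDensity_mul_sq {C p : ℝ} (hp : 0 < p) :
    ∫ x in Set.Ioi 0, limitDensity C p x * x ^ 2 = C * Real.Gamma (p + 2) := by
  rw [Real.Gamma_eq_integral (by linarith), ← integral_const_mul]
  refine setIntegral_congr_fun measurableSet_Ioi fun x hx => ?_
  have hx : 0 < x := hx
  have : x ^ (p + 2 - 1) = x ^ (p - 1) * x ^ 2 := by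
    rw [← Real.rpow_natCast x 2, ← Real.rpow_add hx]
    norm_num
    ring_nf
  simp only [this, limitDensity]
  ring

lemma integral_sq_eq {C p : ℝ} (hC : 0 < C) (hp : 0 < p) {G : ℝ → ℝ} (hG : BoundedProfile G)
    (θ : ℝ) :
    ∫ x in Set.Ioi 0, limitDensity C p x * (G x + θ * x) ^ 2 =
      condVariance C p G + C * Real.Gamma (p + 2) *
        (θ + (∫ x in Set.Ioi 0, limitDensity C p x * x * G x) / (C * Real.Gamma (p + 2))) ^ 2 := by
  have hΓ := Real.Gamma_pos_of_pos (show 0 < p + 2 by linarith)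
  have i0 : IntegrableOn (fun x => limitDensity C p x * (G x * G x)) (Set.Ioi 0) := by
    simpa using (hG.mul hG).integrable C hp 0
  have i1 : IntegrableOn (fun x => limitDensity C p x * x * G x) (Set.Ioi 0) := by
    simpa using hG.integrable C hp 1
  have i2 := integrable_limitDensity_mul_pow C hp 2
  have e : ∀ x, limitDensity C p x * (G x + θ * x) ^ 2 =
      limitDensity C p x * (G x * G x) + 2 * θ * (limitDensity C p x * x * G x) +
        θ ^ 2 * (limitDensity C p x * x ^ 2) := fun x => by ring
  simp_rw [e]
  have i01 : IntegrableOn (fun x => limitDensity C p x * (G x * G x) +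
      2 * θ * (limitDensity C p x * x * G x)) (Set.Ioi 0) := Integrable.add i0 (i1.const_mul _)
  rw [integral_add i01 (i2.const_mul (θ ^ 2)),
    integral_add i0 (i1.const_mul (2 * θ)), integral_const_mul, integral_const_mul, condVariance,
    integral_limitDensity_mul_sq hp]
  field_simp
  ring

lemma condVariance_nonneg {C p : ℝ} (hC : 0 < C) (hp : 0 < p) {G : ℝ → ℝ}
    (hG : BoundedProfile G) : 0 ≤ condVariance C p G := by
  have h := integral_sq_eq hC hp hG
    (-((∫ x in Set.Ioi 0, limitDensity C p x * x * G x) / (C * Real.Gamma (p + 2))))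
  rw [neg_add_cancel, zero_pow two_ne_zero, mul_zero, add_zero] at h
  rw [← h]
  exact setIntegral_nonneg measurableSet_Ioi fun x hx =>
    mul_nonneg (limitDensity_nonneg hC hx) (sq_nonneg _)

/-- The asymptotic regime: weights `a k ∼ C k ^ (p - 1)`, tilted by `exp (-d k)` with `d ∼ 1 / r`,
on a scale `r` which tends to infinity more slowly than the cut-off `N`. -/
structure TiltRegime (C p : ℝ) (a : ℕ → ℝ) (r d : ℕ → ℝ) : Prop where
  C_pos : 0 < C
  p_pos : 0 < p
  a_pos : ∀ k, 1 ≤ k → 0 < a k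
  asymp : (fun k : ℕ => a k) ~[atTop] fun k : ℕ => C * (k : ℝ) ^ (p - 1)
  scale : Tendsto r atTop atTop
  cutoff : Tendsto (fun N : ℕ => (N : ℝ) / r N) atTop atTop
  tilt : Tendsto (fun N => d N * r N) atTop (𝓝 1)

namespace TiltRegime

variable {C p : ℝ} {a : ℕ → ℝ} {r d : ℕ → ℝ}

lemma tendsto_sum (H : TiltRegime C p a r d) {E : Type*} [NormedAddCommGroup E] [NormedSpace ℝ E]
    [CompleteSpace E] {φ : ℕ → ℕ → E} {Φ : ℝ → E} {K : ℝ}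
    (hbound : ∀ᶠ N in atTop, ∀ k : ℕ, 1 ≤ k → ‖φ N k‖ ≤ K * (1 + k / r N) ^ 2)
    (hlim : ∀ᵐ x ∂volume.restrict (Set.Ioi (0 : ℝ)),
      Tendsto (fun N => φ N ⌈r N * x⌉₊) atTop (𝓝 (Φ x))) :
    Tendsto (fun N => (r N ^ p)⁻¹ •
        ∑ k ∈ Finset.Icc 1 N, (a k * Real.exp (-d N * k)) • φ N k) atTop
      (𝓝 (∫ x in Set.Ioi (0 : ℝ), limitDensity C p x • Φ x)) := by
  simpa [limitDensity] using
    tendsto_sum_weights H.p_pos H.asymp one_pos H.scale H.cutoff H.tilt hbound hlim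

/-- `g N k` is a uniformly bounded array of coefficients with scaling limit `G`. -/
structure HasProfile (r : ℕ → ℝ) (g : ℕ → ℕ → ℝ) (G : ℝ → ℝ) : Prop where
  bounded : ∃ K, ∀ᶠ N in atTop, ∀ k : ℕ, 1 ≤ k → |g N k| ≤ K
  tendsto : ∀ᵐ x ∂volume.restrict (Set.Ioi (0 : ℝ)),
    Tendsto (fun N => g N ⌈r N * x⌉₊) atTop (𝓝 (G x))

lemma tendsto_exponent (H : TiltRegime C p a r d) {g : ℕ → ℕ → ℝ} {G : ℝ → ℝ}
    (hg : HasProfile r g G) (θ : ℝ) :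
    Tendsto (fun N => poissonChar (fun k => a k * Real.exp (-d N * k)) N
        (fun k => (r N ^ (p / 2))⁻¹ * g N k) ((r N ^ (p / 2 + 1))⁻¹ * θ)) atTop
      (𝓝 (Complex.exp ((-(1 / 2) * ∫ x in Set.Ioi 0,
        limitDensity C p x * (G x + θ * x) ^ 2 : ℝ) : ℂ))) := by
  obtain ⟨K, hK⟩ := hg.bounded
  have hpow : Tendsto (fun N => r N ^ (p / 2)) atTop atTop :=
    (tendsto_rpow_atTop (half_pos H.p_pos)).comp H.scale
  refine (Complex.continuous_exp.tendsto _).comp ?_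
  have h := H.tendsto_sum (E := ℂ)
    (φ := fun N k => (((r N ^ (p / 2)) ^ 2 : ℝ) : ℂ) *
      expRem ((r N ^ (p / 2))⁻¹ * (g N k + θ * (k / r N))))
    (Φ := fun x => -((G x + θ * x) ^ 2 / 2 : ℝ)) (K := 3 * (|K| + |θ|) ^ 2) ?_ ?_
  · have e : ∫ x in Set.Ioi 0, limitDensity C p x • (-((G x + θ * x) ^ 2 / 2 : ℝ) : ℂ) =
        ((-(1 / 2) * ∫ x in Set.Ioi 0, limitDensity C p x * (G x + θ * x) ^ 2 : ℝ) : ℂ) := by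
      rw [← integral_const_mul, ← integral_complex_ofReal]
      refine integral_congr_ae (Eventually.of_forall fun x => ?_)
      simp only [Complex.real_smul]
      push_cast
      ring
    rw [e] at h
    refine h.congr' ?_
    filter_upwards [H.scale.eventually_gt_atTop 0] with N hN
    have h1 : (r N ^ (p / 2)) ^ 2 = r N ^ p := by
      rw [← Real.rpow_natCast, ← Real.rpow_mul hN.le]; norm_num
    have hp0 : ((r N ^ p : ℝ) : ℂ) ≠ 0 := by
      exact_mod_cast (Real.rpow_pos_of_pos hN p).ne'
    rw [Finset.smul_sum]
    refine Finset.sum_congr rfl fun k _ => ?_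
    rw [h1, Complex.real_smul, Complex.real_smul, Complex.ofReal_inv]
    have h2 : (r N ^ (p / 2))⁻¹ * g N k + k * ((r N ^ (p / 2 + 1))⁻¹ * θ) =
        (r N ^ (p / 2))⁻¹ * (g N k + θ * (k / r N)) := by
      rw [Real.rpow_add_one hN.ne']
      field_simp
    rw [h2]
    field_simp
  · filter_upwards [hK, H.scale.eventually_gt_atTop 0] with N hN hr k hk
    set y := g N k + θ * (k / r N) with hy
    have hρ : 0 < r N ^ (p / 2) := Real.rpow_pos_of_pos hr _
    have h1 : |y| ≤ (|K| + |θ|) * (1 + k / r N) := by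
      have h2 : 0 ≤ (k : ℝ) / r N := by positivity
      calc |y| ≤ |g N k| + |θ * (k / r N)| := abs_add_le _ _
        _ = |g N k| + |θ| * (k / r N) := by rw [abs_mul, abs_of_nonneg h2]
        _ ≤ |K| + |θ| * (k / r N) := by
          linarith [hN k hk, le_abs_self K]
        _ ≤ _ := by nlinarith [abs_nonneg K, abs_nonneg θ]
    rw [norm_mul, Complex.norm_real, Real.norm_eq_abs, abs_of_pos (by positivity)]
    calc (r N ^ (p / 2)) ^ 2 * ‖expRem ((r N ^ (p / 2))⁻¹ * y)‖
        ≤ (r N ^ (p / 2)) ^ 2 * (3 * ((r N ^ (p / 2))⁻¹ * y) ^ 2) := by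
          gcongr; exact norm_expRem_le _
      _ = 3 * |y| ^ 2 := by rw [sq_abs]; field_simp
      _ ≤ 3 * ((|K| + |θ|) * (1 + k / r N)) ^ 2 := by gcongr
      _ = _ := by ring
  · filter_upwards [hg.tendsto, ae_restrict_mem measurableSet_Ioi] with x hx hx0
    have h1 := tendsto_ceil_mul_div H.scale (le_of_lt hx0)
    exact tendsto_sq_mul_expRem hpow (hx.add (h1.const_mul θ))

/-- The Gaussian bound near the origin, and the exponentially small bound elsewhere on the
circle. -/
lemma exists_norm_poissonChar_le (H : TiltRegime C p a r d) {g : ℕ → ℕ → ℝ} {G : ℝ → ℝ}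
    (hg : HasProfile r g G) :
    ∃ c L : ℝ, 0 < c ∧ 0 ≤ L ∧ ∀ᶠ N in atTop, ∀ t : ℝ, |t| ≤ Real.pi →
      ‖poissonChar (fun k => a k * Real.exp (-d N * k)) N
        (fun k => (r N ^ (p / 2))⁻¹ * g N k) t‖ ≤
        L * Real.exp (-(c * r N ^ p * min 1 ((r N * t) ^ 2))) := by
  obtain ⟨c, hc, hmin⟩ := exists_le_sum_weights_one_sub_cos H.C_pos H.a_pos H.asymp H.p_pos
    H.scale H.cutoff H.tilt
  obtain ⟨K, hK⟩ := hg.bounded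
  have hmass := H.tendsto_sum (E := ℝ) (φ := fun _ _ => 1) (Φ := fun _ => 1) (K := 1)
    (by
      filter_upwards [H.scale.eventually_gt_atTop 0] with N hN k _
      have : 0 ≤ (k : ℝ) / r N := by positivity
      rw [norm_one]
      nlinarith)
    (Eventually.of_forall fun x => tendsto_const_nhds)
  set M := ∫ x in Set.Ioi (0 : ℝ), limitDensity C p x • (1 : ℝ)
  refine ⟨c / 2, Real.exp (K ^ 2 * (M + 1)), half_pos hc, (Real.exp_pos _).le, ?_⟩
  filter_upwards [hmin, hK, hmass.eventually_le_const (lt_add_one M),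
    H.scale.eventually_gt_atTop 0] with N h1 h2 h3 hr t ht
  rw [norm_poissonChar, ← Real.exp_add]
  refine Real.exp_le_exp.2 ?_
  set w : ℕ → ℝ := fun k => a k * Real.exp (-d N * k) with hw
  have hwpos : ∀ k ∈ Finset.Icc 1 N, 0 ≤ w k := fun k hk => by
    have := H.a_pos k (Finset.mem_Icc.1 hk).1
    positivity
  set s : ℕ → ℝ := fun k => (r N ^ (p / 2))⁻¹ * g N k with hs
  have hcos : ∀ k ∈ Finset.Icc 1 N, 1 - Real.cos (s k) ≤ (r N ^ p)⁻¹ * K ^ 2 := by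
    intro k hk
    have h4 := h2 k (Finset.mem_Icc.1 hk).1
    have h5 : (r N ^ (p / 2)) ^ 2 = r N ^ p := by
      rw [← Real.rpow_natCast, ← Real.rpow_mul hr.le]; norm_num
    have h6 : s k ^ 2 = (r N ^ p)⁻¹ * |g N k| ^ 2 := by
      rw [hs, mul_pow, inv_pow, h5, sq_abs]
    have h7 : s k ^ 2 ≤ (r N ^ p)⁻¹ * K ^ 2 := by
      rw [h6]
      gcongr
    have := Real.one_sub_sq_div_two_le_cos (x := s k)
    nlinarith [sq_nonneg (s k)]
  have hsum1 : ∑ k ∈ Finset.Icc 1 N, w k * (1 - Real.cos (s k)) ≤ K ^ 2 * (M + 1) := by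
    calc ∑ k ∈ Finset.Icc 1 N, w k * (1 - Real.cos (s k))
        ≤ ∑ k ∈ Finset.Icc 1 N, w k * ((r N ^ p)⁻¹ * K ^ 2) :=
          Finset.sum_le_sum fun k hk => mul_le_mul_of_nonneg_left (hcos k hk) (hwpos k hk)
      _ = K ^ 2 * ((r N ^ p)⁻¹ • ∑ k ∈ Finset.Icc 1 N, w k • (1 : ℝ)) := by
          simp only [smul_eq_mul, mul_one, ← Finset.sum_mul]
          ring
      _ ≤ _ := by gcongr
  have hsum2 : (1 / 2) * ∑ k ∈ Finset.Icc 1 N, w k * (1 - Real.cos (k * t)) -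
      ∑ k ∈ Finset.Icc 1 N, w k * (1 - Real.cos (s k)) ≤
      ∑ k ∈ Finset.Icc 1 N, w k * (1 - Real.cos (s k + k * t)) := by
    rw [Finset.mul_sum, ← Finset.sum_sub_distrib]
    refine Finset.sum_le_sum fun k hk => ?_
    have := mul_le_mul_of_nonneg_left (half_one_sub_cos_le (k * t) (s k)) (hwpos k hk)
    rw [add_comm (s k)]
    linarith
  have := h1 t ht
  linarith

/-- The local limit theorem, in Fourier form. -/
theorem tendsto_integral_poissonChar (H : TiltRegime C p a r d) {g : ℕ → ℕ → ℝ} {G : ℝ → ℝ}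
    (hg : HasProfile r g G) :
    Tendsto (fun N => (r N ^ (p / 2 + 1)) • ∫ t in -Real.pi..Real.pi,
        poissonChar (fun k => a k * Real.exp (-d N * k)) N
          (fun k => (r N ^ (p / 2))⁻¹ * g N k) t) atTop
      (𝓝 (∫ θ : ℝ, Complex.exp ((-(1 / 2) * ∫ x in Set.Ioi 0,
        limitDensity C p x * (G x + θ * x) ^ 2 : ℝ) : ℂ))) := by
  obtain ⟨c, L, hc, hL, hb⟩ := H.exists_norm_poissonChar_le hg
  set F : ℕ → ℝ → ℂ := fun N θ => poissonChar (fun k => a k * Real.exp (-d N * k)) N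
    (fun k => (r N ^ (p / 2))⁻¹ * g N k) ((r N ^ (p / 2 + 1))⁻¹ * θ) with hF
  set S : ℕ → Set ℝ := fun N =>
    Set.Ioc (r N ^ (p / 2 + 1) * -Real.pi) (r N ^ (p / 2 + 1) * Real.pi) with hS
  have hρ : Tendsto (fun N => r N ^ (p / 2 + 1)) atTop atTop :=
    (tendsto_rpow_atTop (by linarith [H.p_pos])).comp H.scale
  have heq : ∀ᶠ N in atTop, ∫ θ, (S N).indicator (F N) θ =
      (r N ^ (p / 2 + 1)) • ∫ t in -Real.pi..Real.pi,
        poissonChar (fun k => a k * Real.exp (-d N * k)) N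
          (fun k => (r N ^ (p / 2))⁻¹ * g N k) t := by
    filter_upwards [hρ.eventually_gt_atTop 0] with N hN
    rw [integral_indicator measurableSet_Ioc, ← intervalIntegral.integral_of_le,
      ← intervalIntegral.smul_integral_comp_mul_left]
    · congr 1
      refine intervalIntegral.integral_congr fun t _ => ?_
      simp only [hF, inv_mul_cancel_left₀ hN.ne']
    · have := Real.pi_pos
      gcongr
      linarith
  refine Tendsto.congr' heq ?_
  refine tendsto_integral_filter_of_dominated_convergence
    (fun θ => L * (Real.exp (-c * θ ^ 2) + 2 * (1 + θ ^ 2)⁻¹)) ?_ ?_ ?_ ?_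
  · refine Eventually.of_forall fun N => ?_
    have : Continuous (F N) := (continuous_poissonChar _ _ _).comp (by fun_prop)
    exact this.aestronglyMeasurable.indicator measurableSet_Ioc
  · have hsmall : ∀ᶠ N in atTop,
        (1 + Real.pi ^ 2 * (r N ^ p) ^ ((p + 2) / p)) * Real.exp (-c * r N ^ p) ≤ 2 := by
      have hrp : Tendsto (fun N => r N ^ p) atTop atTop :=
        (tendsto_rpow_atTop H.p_pos).comp H.scale
      have h1 := (tendsto_rpow_mul_exp_neg_mul_atTop_nhds_zero ((p + 2) / p) c hc).comp hrp
      have h2 := (h1.const_mul (Real.pi ^ 2)).eventually_le_const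
        (show Real.pi ^ 2 * 0 < 1 by norm_num)
      filter_upwards [h2, hrp.eventually_ge_atTop 0] with N h3 h4
      have : Real.exp (-c * r N ^ p) ≤ 1 := by
        rw [Real.exp_le_one_iff]
        nlinarith
      simp only [Function.comp_apply] at h3
      linarith
    filter_upwards [hb, hsmall, H.scale.eventually_gt_atTop 0] with N hbN hsN hr
    refine Eventually.of_forall fun θ => ?_
    by_cases hθ : θ ∈ S N
    · rw [Set.indicator_of_mem hθ]
      have hρN : 0 < r N ^ (p / 2 + 1) := Real.rpow_pos_of_pos hr _
      have hrp : 0 < r N ^ p := Real.rpow_pos_of_pos hr _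
      have habs : |θ| ≤ r N ^ (p / 2 + 1) * Real.pi :=
        abs_le.2 ⟨by linarith [hθ.1], hθ.2⟩
      have ht : |(r N ^ (p / 2 + 1))⁻¹ * θ| ≤ Real.pi := by
        rw [abs_mul, abs_of_pos (inv_pos.2 hρN), inv_mul_le_iff₀ hρN]
        exact habs
      refine (hbN _ ht).trans ?_
      gcongr
      have e1 : r N ^ p * (r N * ((r N ^ (p / 2 + 1))⁻¹ * θ)) ^ 2 = θ ^ 2 := by
        have h5 : (r N ^ (p / 2)) ^ 2 = r N ^ p := by
          rw [← Real.rpow_natCast, ← Real.rpow_mul hr.le]; norm_num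
        rw [← h5, Real.rpow_add_one hr.ne']
        have : 0 < r N ^ (p / 2) := Real.rpow_pos_of_pos hr _
        field_simp
      -- Beyond `|θ| = r ^ (p / 2)` the bound is `exp (-c r ^ p)`, while `θ²` is at most of order
      -- `r ^ (p + 2)` on the range of integration.
      rcases le_total 1 ((r N * ((r N ^ (p / 2 + 1))⁻¹ * θ)) ^ 2) with h | h
      · rw [min_eq_left h]
        have h6 : (1 + θ ^ 2) * Real.exp (-(c * r N ^ p)) ≤ 2 := by
          refine le_trans ?_ hsN
          rw [neg_mul]
          gcongr
          rw [← Real.rpow_mul hr.le, mul_div_cancel₀ _ H.p_pos.ne', ← sq_abs]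
          calc |θ| ^ 2 ≤ (r N ^ (p / 2 + 1) * Real.pi) ^ 2 := by gcongr
            _ = Real.pi ^ 2 * r N ^ (p + 2) := by
              rw [mul_pow, ← Real.rpow_natCast (r N ^ _), ← Real.rpow_mul hr.le]
              push_cast
              ring_nf
        have h7 : Real.exp (-(c * r N ^ p * 1)) ≤ 2 * (1 + θ ^ 2)⁻¹ := by
          rw [mul_one, ← div_eq_mul_inv, le_div_iff₀ (by positivity), mul_comm]
          exact h6
        exact h7.trans (le_add_of_nonneg_left (Real.exp_pos _).le)
      · rw [min_eq_right h, mul_assoc, e1, ← neg_mul]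
        exact le_add_of_nonneg_right (by positivity)
    · rw [Set.indicator_of_notMem hθ, norm_zero]
      positivity
  · exact ((integrable_exp_neg_mul_sq hc).add (integrable_inv_one_add_sq.const_mul 2)).const_mul L
  · refine Eventually.of_forall fun θ => ?_
    refine (H.tendsto_exponent hg θ).congr' ?_
    filter_upwards [hρ.eventually_gt_atTop |θ|] with N hN
    have hπ := Real.pi_gt_three
    have h0 := abs_nonneg θ
    rw [Set.indicator_of_mem]
    constructor
    · nlinarith [neg_abs_le θ]
    · nlinarith [le_abs_self θ]

/-- **The conditional central limit theorem.** Under the Gibbs measure a centred linear statistic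
with profile `G`, on the scale `r ^ (p / 2)`, is asymptotically Gaussian with variance
`condVariance C p G`. -/
theorem tendsto_gibbs_charFun (H : TiltRegime C p a r d)
    (hd : ∀ N : ℕ, 1 ≤ N →
      ∑ k ∈ Finset.Icc 1 N, (k : ℝ) * a k * Real.exp (-d N * k) = (N : ℝ))
    {g : ℕ → ℕ → ℝ} {G : ℝ → ℝ} (hg : HasProfile r g G) (hG : BoundedProfile G) :
    Tendsto (fun N => ∫ η, Complex.exp ((∑ k ∈ Finset.Icc 1 N, (r N ^ (p / 2))⁻¹ * g N k *
        (mult η k - a k * Real.exp (-d N * k)) : ℝ) * Complex.I)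
        ∂(gibbs a H.a_pos N).toMeasure) atTop
      (𝓝 (Real.exp (-(1 / 2) * condVariance C p G) : ℂ)) := by
  have hΓ := Real.Gamma_pos_of_pos (show 0 < p + 2 by linarith [H.p_pos])
  set A := C * Real.Gamma (p + 2) with hA
  have hA0 : 0 < A := mul_pos H.C_pos hΓ
  have hint : ∀ {G : ℝ → ℝ}, BoundedProfile G →
      ∫ θ : ℝ, Complex.exp ((-(1 / 2) * ∫ x in Set.Ioi 0,
        limitDensity C p x * (G x + θ * x) ^ 2 : ℝ) : ℂ) =
      ((Real.exp (-(1 / 2) * condVariance C p G) *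
        ∫ θ : ℝ, Real.exp (-(A / 2) * θ ^ 2) : ℝ) : ℂ) := by
    intro G hG
    set b := (∫ x in Set.Ioi 0, limitDensity C p x * x * G x) / A with hb
    rw [← integral_add_right_eq_self (fun θ : ℝ => Real.exp (-(A / 2) * θ ^ 2)) b,
      ← integral_const_mul, ← integral_complex_ofReal]
    refine integral_congr_ae (Eventually.of_forall fun θ => ?_)
    simp only
    rw [integral_sq_eq H.C_pos H.p_pos hG θ, ← Complex.ofReal_exp, ← Real.exp_add]
    congr 2
    ring
  have h0 : BoundedProfile fun _ => 0 := ⟨measurable_const, 0, fun x => by simp⟩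
  have hg0 : HasProfile r (fun _ _ => 0) fun _ => 0 :=
    ⟨⟨0, Eventually.of_forall fun N k _ => by simp⟩,
      Eventually.of_forall fun x => tendsto_const_nhds⟩
  have hv0 : condVariance C p (fun _ => 0) = 0 := by simp [condVariance]
  have t1 := H.tendsto_integral_poissonChar hg
  have t0 := H.tendsto_integral_poissonChar hg0
  rw [hint hG] at t1
  rw [hint h0, hv0, mul_zero, Real.exp_zero, one_mul] at t0
  have hI : 0 < ∫ θ : ℝ, Real.exp (-(A / 2) * θ ^ 2) := by
    rw [integral_gaussian]
    have := Real.pi_pos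
    positivity
  have h := t1.div t0 (by exact_mod_cast hI.ne')
  have e : (((Real.exp (-(1 / 2) * condVariance C p G) *
      ∫ θ : ℝ, Real.exp (-(A / 2) * θ ^ 2) : ℝ) : ℂ) /
      ((∫ θ : ℝ, Real.exp (-(A / 2) * θ ^ 2) : ℝ) : ℂ)) =
      (Real.exp (-(1 / 2) * condVariance C p G) : ℂ) := by
    rw [← Complex.ofReal_div, mul_div_cancel_right₀ _ hI.ne']
  rw [e] at h
  refine h.congr' ?_
  filter_upwards [H.scale.eventually_gt_atTop 0, eventually_ge_atTop 1] with N hr hN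
  rw [gibbs_charFun_eq H.a_pos (hd N hN)]
  have hρ : ((r N ^ (p / 2 + 1) : ℝ) : ℂ) ≠ 0 := by
    exact_mod_cast (Real.rpow_pos_of_pos hr _).ne'
  simp only [Pi.div_apply, Complex.real_smul, mul_zero]
  rw [mul_div_mul_left _ _ hρ]
  rfl

end TiltRegime

/-! ### Tail counts and their normalisation -/

lemma tiltRegime_scaling {C p : ℝ} (hC : 0 < C) (hp : 0 < p) {a : ℕ → ℝ}
    (ha : ∀ k, 1 ≤ k → 0 < a k)
    (hasymp : (fun k : ℕ => a k) ~[atTop] fun k : ℕ => C * (k : ℝ) ^ (p - 1)) {δ : ℕ → ℝ}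
    (hδ : ∀ N : ℕ, 1 ≤ N →
      ∑ k ∈ Finset.Icc 1 N, (k : ℝ) * a k * Real.exp (-δ N * k) = (N : ℝ)) :
    TiltRegime C p a (scaling C p) δ where
  C_pos := hC
  p_pos := hp
  a_pos := ha
  asymp := hasymp
  scale := tendsto_scaling hC hp
  cutoff := tendsto_div_scaling hC hp
  tilt := tendsto_tilt_mul_scaling hC hp ha hasymp hδ

/-- The indicator of `M ≤ k`. -/
noncomputable def tailInd (M k : ℕ) : ℝ := if M ≤ k then 1 else 0

lemma sumAbove_eq (a : ℕ → ℝ) (d : ℝ) (N M : ℕ) :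
    sumAbove a d N M = ∑ k ∈ Finset.Icc 1 N, a k * Real.exp (-d * k) * tailInd M k := by
  simp [sumAbove, Finset.sum_filter, tailInd]

lemma young_natCast_eq {N : ℕ} (η : Nat.Partition N) (M : ℕ) :
    young η (M : ℝ) = ∑ k ∈ Finset.Icc 1 N, mult η k * tailInd M k := by
  simp [young, Finset.sum_filter, tailInd]

lemma young_ceil {N : ℕ} (η : Nat.Partition N) (x : ℝ) : young η (⌈x⌉₊ : ℝ) = young η x := by
  unfold young
  congr 1
  refine Finset.filter_congr fun k _ => ?_
  rw [Nat.cast_le, Nat.ceil_le]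

lemma sumBelow_eq (a : ℕ → ℝ) (d : ℝ) {N M : ℕ} (h : M ≤ N + 1) :
    sumBelow a d M = ∑ k ∈ Finset.Icc 1 N, a k * Real.exp (-d * k) * (1 - tailInd M k) := by
  have e : ∀ k, a k * Real.exp (-d * k) * (1 - tailInd M k) =
      if k < M then a k * Real.exp (-d * k) else 0 := by
    intro k
    by_cases hk : M ≤ k
    · simp [tailInd, hk]
    · simp [tailInd, hk, not_le.1 hk]
  simp_rw [e]
  rw [← Finset.sum_filter, sumBelow]
  congr 1
  ext k
  simp only [Finset.mem_Ico, Finset.mem_filter, Finset.mem_Icc]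
  omega

/-- For `x ≥ 0`, the integer `rd x` is within distance one of `x`. -/
def IsRounding (rd : ℝ → ℕ) : Prop := ∀ x : ℝ, 0 ≤ x → x - 1 ≤ rd x ∧ (rd x : ℝ) ≤ x + 1

lemma isRounding_floor : IsRounding fun x => ⌊x⌋₊ := fun x hx =>
  ⟨by linarith [Nat.lt_floor_add_one x], by linarith [Nat.floor_le hx]⟩

lemma isRounding_ceil : IsRounding fun x => ⌈x⌉₊ := fun x hx =>
  ⟨by linarith [Nat.le_ceil x], (Nat.ceil_lt_add_one hx).le⟩

lemma IsRounding.tendsto_div {rd : ℝ → ℕ} (hrd : IsRounding rd) {r : ℕ → ℝ}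
    (hr : Tendsto r atTop atTop) {u : ℝ} (hu : 0 ≤ u) :
    Tendsto (fun N => (rd (u * r N) : ℝ) / r N) atTop (𝓝 u) := by
  have hinv : Tendsto (fun N => (r N)⁻¹) atTop (𝓝 0) := hr.inv_tendsto_atTop
  have h1 : Tendsto (fun N => u - (r N)⁻¹) atTop (𝓝 u) := by
    simpa using tendsto_const_nhds.sub hinv
  have h2 : Tendsto (fun N => u + (r N)⁻¹) atTop (𝓝 u) := by
    simpa using tendsto_const_nhds.add hinv
  refine tendsto_of_tendsto_of_tendsto_of_le_of_le' h1 h2 ?_ ?_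
  all_goals
    filter_upwards [hr.eventually_gt_atTop 0] with N hN
    have h := hrd (u * r N) (by positivity)
  · rw [le_div_iff₀ hN, sub_mul, inv_mul_cancel₀ hN.ne']
    exact h.1
  · rw [div_le_iff₀ hN, add_mul, inv_mul_cancel₀ hN.ne']
    exact h.2

/-- The indicator of `[u, ∞)`, the profile of the tail counts. -/
noncomputable def tailProfile (u x : ℝ) : ℝ := if u ≤ x then 1 else 0

lemma boundedProfile_tailProfile (u : ℝ) : BoundedProfile (tailProfile u) := by
  refine ⟨Measurable.ite measurableSet_Ici measurable_const measurable_const, 1, fun x => ?_⟩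
  unfold tailProfile
  split_ifs <;> simp

lemma abs_tailInd_le (M k : ℕ) : |tailInd M k| ≤ 1 := by
  unfold tailInd
  split_ifs <;> simp

lemma IsRounding.tendsto_tailInd {rd : ℝ → ℕ} (hrd : IsRounding rd) {r : ℕ → ℝ}
    (hr : Tendsto r atTop atTop) {u : ℝ} (hu : 0 ≤ u) :
    ∀ᵐ x ∂volume.restrict (Set.Ioi (0 : ℝ)),
      Tendsto (fun N => tailInd (rd (u * r N)) ⌈r N * x⌉₊) atTop (𝓝 (tailProfile u x)) := by
  have hne : ∀ᵐ x ∂volume.restrict (Set.Ioi (0 : ℝ)), x ≠ u :=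
    ae_restrict_of_ae (Measure.ae_ne volume u)
  filter_upwards [hne, ae_restrict_mem measurableSet_Ioi] with x hx hx0
  have h1 := hrd.tendsto_div hr hu
  have h2 := tendsto_ceil_mul_div hr (le_of_lt hx0)
  refine tendsto_const_nhds.congr' ?_
  rcases lt_or_gt_of_ne hx with h | h
  · filter_upwards [h2.eventually_lt h1 h, hr.eventually_gt_atTop 0] with N hN hr0
    rw [div_lt_div_iff_of_pos_right hr0, Nat.cast_lt] at hN
    rw [tailProfile, tailInd, if_neg (not_le.2 h), if_neg (not_le.2 hN)]
  · filter_upwards [h1.eventually_lt h2 h, hr.eventually_gt_atTop 0] with N hN hr0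
    rw [div_lt_div_iff_of_pos_right hr0, Nat.cast_lt] at hN
    rw [tailProfile, tailInd, if_pos h.le, if_pos hN.le]

lemma integral_mul_tailProfile (f : ℝ → ℝ) {u : ℝ} (hu : 0 ≤ u) :
    ∫ x in Set.Ioi 0, f x * tailProfile u x = ∫ x in Set.Ioi u, f x := by
  have e : ∀ x, f x * tailProfile u x = (Set.Ici u).indicator f x := fun x => by
    by_cases h : u ≤ x <;> simp [tailProfile, h]
  simp_rw [e]
  rw [← integral_Ici_eq_integral_Ioi, ← integral_Ici_eq_integral_Ioi,
    setIntegral_indicator measurableSet_Ici, Set.inter_eq_self_of_subset_right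
      (Set.Ici_subset_Ici.2 hu)]

lemma integral_limitDensity_mul_tailProfile (C p : ℝ) {u : ℝ} (hu : 0 ≤ u) :
    ∫ x in Set.Ioi 0, limitDensity C p x * tailProfile u x = bFun C (p - 1) u := by
  rw [integral_mul_tailProfile _ hu, bFun, upperGamma, sub_add_cancel]
  simp only [limitDensity]
  rw [integral_const_mul]

lemma integral_limitDensity_mul_id_mul_tailProfile (C p : ℝ) {u : ℝ} (hu : 0 ≤ u) :
    ∫ x in Set.Ioi 0, limitDensity C p x * x * tailProfile u x = bFun C p u := by
  rw [integral_mul_tailProfile _ hu, bFun, upperGamma, add_sub_cancel_right, ← integral_const_mul]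
  refine setIntegral_congr_fun measurableSet_Ioi fun x hx => ?_
  have hx : 0 < x := hu.trans_lt hx
  have : x ^ p = x ^ (p - 1) * x := by rw [← Real.rpow_add_one hx.ne']; ring_nf
  simp only [limitDensity, this]
  ring

lemma integral_limitDensity_mul_one_sub_tailProfile (C p : ℝ) {u : ℝ} (hu : 0 ≤ u) :
    ∫ x in Set.Ioi 0, limitDensity C p x * (1 - tailProfile u x) = fZero C (p - 1) u := by
  have e : ∀ x, limitDensity C p x * (1 - tailProfile u x) =
      (Set.Iio u).indicator (limitDensity C p) x := fun x => by
    by_cases h : u ≤ x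
    · simp [tailProfile, h]
    · simp [tailProfile, h, not_le.1 h]
  simp_rw [e]
  rw [setIntegral_indicator measurableSet_Iio, Set.Ioi_inter_Iio, fZero,
    intervalIntegral.integral_of_le hu, integral_Ioc_eq_integral_Ioo, ← integral_const_mul]
  rfl

lemma fZero_pos {C p u : ℝ} (hC : 0 < C) (hp : 0 < p) (hu : 0 < u) : 0 < fZero C (p - 1) u := by
  refine mul_pos hC (intervalIntegral.intervalIntegral_pos_of_pos_on ?_ (fun x hx => ?_) hu)
  · rw [intervalIntegrable_iff_integrableOn_Ioc_of_le hu.le]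
    have := (Real.GammaIntegral_convergent hp).mono_set
      (Set.Ioc_subset_Ioi_self : Set.Ioc 0 u ⊆ Set.Ioi 0)
    simpa only [mul_comm] using this
  · have := hx.1
    positivity

namespace TiltRegime

variable {C p : ℝ} {a : ℕ → ℝ} {r d : ℕ → ℝ}

lemma tendsto_sumAbove (H : TiltRegime C p a r d) {rd : ℝ → ℕ} (hrd : IsRounding rd) {u : ℝ}
    (hu : 0 ≤ u) :
    Tendsto (fun N => (r N ^ p)⁻¹ * sumAbove a (d N) N (rd (u * r N))) atTop
      (𝓝 (bFun C (p - 1) u)) := by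
  have h := H.tendsto_sum (φ := fun N k => tailInd (rd (u * r N)) k) (Φ := tailProfile u) (K := 1)
    ?_ (hrd.tendsto_tailInd H.scale hu)
  · simp only [smul_eq_mul, integral_limitDensity_mul_tailProfile C p hu, ← sumAbove_eq] at h
    exact h
  · filter_upwards [H.scale.eventually_gt_atTop 0] with N hN k _
    have h0 : 0 ≤ (k : ℝ) / r N := by positivity
    have := abs_tailInd_le (rd (u * r N)) k
    rw [Real.norm_eq_abs]
    nlinarith

lemma tendsto_sumBelow (H : TiltRegime C p a r d) {rd : ℝ → ℕ} (hrd : IsRounding rd) {u : ℝ}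
    (hu : 0 ≤ u) :
    Tendsto (fun N => (r N ^ p)⁻¹ * sumBelow a (d N) (rd (u * r N))) atTop
      (𝓝 (fZero C (p - 1) u)) := by
  have h := H.tendsto_sum (φ := fun N k => 1 - tailInd (rd (u * r N)) k)
    (Φ := fun x => 1 - tailProfile u x) (K := 2) ?_ ?_
  · simp only [smul_eq_mul, integral_limitDensity_mul_one_sub_tailProfile C p hu] at h
    refine h.congr' ?_
    filter_upwards [H.scale.eventually_gt_atTop 0,
      (hrd.tendsto_div H.scale hu).eventually_lt_const (lt_add_one u),
      H.cutoff.eventually_ge_atTop (u + 1)] with N hr h1 h2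
    have h3 := (h1.trans_le h2).le
    rw [div_le_div_iff_of_pos_right hr, Nat.cast_le] at h3
    rw [sumBelow_eq a (d N) (h3.trans (Nat.le_succ N))]
  · filter_upwards [H.scale.eventually_gt_atTop 0] with N hN k _
    have h0 : 0 ≤ (k : ℝ) / r N := by positivity
    have h1 := abs_tailInd_le (rd (u * r N)) k
    have h2 : ‖1 - tailInd (rd (u * r N)) k‖ ≤ 2 := by
      rw [Real.norm_eq_abs]
      refine (abs_sub _ _).trans ?_
      rw [abs_one]
      linarith
    nlinarith
  · filter_upwards [hrd.tendsto_tailInd H.scale hu] with x hx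
    exact tendsto_const_nhds.sub hx

/-- The ratio of the normalisation in `nuHat` to `r ^ (-p / 2)`. -/
noncomputable def normRatio (C p : ℝ) (a : ℕ → ℝ) (r d : ℕ → ℝ) (rd : ℝ → ℕ) (u₁ : ℝ) (N : ℕ) :
    ℝ :=
  √(fZero C (p - 1) u₁) / √((r N ^ p)⁻¹ * sumBelow a (d N) (rd (u₁ * r N)))

lemma tendsto_normRatio (H : TiltRegime C p a r d) {rd : ℝ → ℕ} (hrd : IsRounding rd) {u₁ : ℝ}
    (hu : 0 < u₁) : Tendsto (normRatio C p a r d rd u₁) atTop (𝓝 1) := by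
  have hf := Real.sqrt_pos.2 (fZero_pos H.C_pos H.p_pos hu)
  have h := (Real.continuous_sqrt.tendsto _).comp (H.tendsto_sumBelow hrd hu.le)
  have h2 := (tendsto_const_nhds (x := √(fZero C (p - 1) u₁))).div h hf.ne'
  rw [div_self hf.ne'] at h2
  exact h2

lemma nuHat_eq {rd : ℝ → ℕ} {u₁ : ℝ} {N : ℕ} (hr : 0 < r N) (M : ℕ) (η : Nat.Partition N) :
    nuHat C p a (d N) u₁ (rd (u₁ * r N)) M η =
      normRatio C p a r d rd u₁ N * ((r N ^ (p / 2))⁻¹ * (young η M - sumAbove a (d N) N M)) := by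
  have h1 : √(r N ^ p) = r N ^ (p / 2) := by
    rw [Real.sqrt_eq_rpow, ← Real.rpow_mul hr.le]; ring_nf
  have h2 : 0 < r N ^ (p / 2) := Real.rpow_pos_of_pos hr _
  rw [nuHat, normRatio, Real.sqrt_mul (inv_nonneg.2 (Real.rpow_nonneg hr.le _)), Real.sqrt_inv, h1]
  field_simp

lemma young_sub_sumAbove {N : ℕ} (M : ℕ) (η : Nat.Partition N) (x : ℝ) :
    young η M - sumAbove a x N M =
      ∑ k ∈ Finset.Icc 1 N, tailInd M k * (mult η k - a k * Real.exp (-x * k)) := by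
  rw [young_natCast_eq, sumAbove_eq, ← Finset.sum_sub_distrib]
  exact Finset.sum_congr rfl fun k _ => by ring

end TiltRegime

/-! ### The covariance matrix -/

section Covariance

variable {q : ℕ}

/-- The profile of the linear combination with coefficients `ξ` of the tail counts. -/
noncomputable def combProfile (u ξ : Fin q → ℝ) (x : ℝ) : ℝ := ∑ j, ξ j * tailProfile (u j) x

lemma boundedProfile_combProfile (u ξ : Fin q → ℝ) : BoundedProfile (combProfile u ξ) := by
  refine ⟨Finset.measurable_fun_sum _ fun j _ =>
    (boundedProfile_tailProfile (u j)).measurable.const_mul _, ∑ j, |ξ j|, fun x => ?_⟩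
  refine (Finset.abs_sum_le_sum_abs _ _).trans (Finset.sum_le_sum fun j _ => ?_)
  rw [abs_mul]
  have : |tailProfile (u j) x| ≤ 1 := by unfold tailProfile; split_ifs <;> simp
  exact mul_le_of_le_one_right (abs_nonneg _) this

lemma condVariance_combProfile {C p : ℝ} (hp : 0 < p) {u : Fin q → ℝ} (hu : ∀ j, 0 < u j)
    (hmono : StrictMono u) (ξ : Fin q → ℝ) :
    condVariance C p (combProfile u ξ) = ξ ⬝ᵥ (limitCov C p u).mulVec ξ := by
  have hmul : ∀ i j x, tailProfile (u i) x * tailProfile (u j) x = tailProfile (u (max i j)) x := by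
    intro i j x
    rw [hmono.monotone.map_max]
    by_cases h1 : u i ≤ x <;> by_cases h2 : u j ≤ x <;> simp [tailProfile, h1, h2]
  have h1 : ∫ x in Set.Ioi 0, limitDensity C p x * (combProfile u ξ x * combProfile u ξ x) =
      ∑ i, ∑ j, ξ i * ξ j * bFun C (p - 1) (u (max i j)) := by
    have e : ∀ x, limitDensity C p x * (combProfile u ξ x * combProfile u ξ x) =
        ∑ i, ∑ j, ξ i * ξ j * (limitDensity C p x * tailProfile (u (max i j)) x) := by
      intro x
      rw [combProfile, Finset.sum_mul_sum, Finset.mul_sum]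
      refine Finset.sum_congr rfl fun i _ => ?_
      rw [Finset.mul_sum]
      refine Finset.sum_congr rfl fun j _ => ?_
      rw [← hmul]
      ring
    have hi : ∀ i j, IntegrableOn (fun x => ξ i * ξ j *
        (limitDensity C p x * tailProfile (u (max i j)) x)) (Set.Ioi 0) := fun i j => by
      have := (boundedProfile_tailProfile (u (max i j))).integrable C hp 0
      simp only [pow_zero, mul_one] at this
      exact this.const_mul _
    simp_rw [e]
    rw [integral_finsetSum _ fun i _ => integrable_finsetSum _ fun j _ => hi i j]
    refine Finset.sum_congr rfl fun i _ => ?_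
    rw [integral_finsetSum _ fun j _ => hi i j]
    refine Finset.sum_congr rfl fun j _ => ?_
    rw [integral_const_mul, integral_limitDensity_mul_tailProfile C p (hu _).le]
  have h2 : ∫ x in Set.Ioi 0, limitDensity C p x * x * combProfile u ξ x =
      ∑ i, ξ i * bFun C p (u i) := by
    have e : ∀ x, limitDensity C p x * x * combProfile u ξ x =
        ∑ i, ξ i * (limitDensity C p x * x * tailProfile (u i) x) := by
      intro x
      rw [combProfile, Finset.mul_sum]
      exact Finset.sum_congr rfl fun i _ => by ring
    simp_rw [e]
    rw [integral_finsetSum]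
    · refine Finset.sum_congr rfl fun i _ => ?_
      rw [integral_const_mul, integral_limitDensity_mul_id_mul_tailProfile C p (hu _).le]
    · intro i _
      have := (boundedProfile_tailProfile (u i)).integrable C hp 1
      simp only [pow_one] at this
      exact this.const_mul _
  rw [condVariance, h1, h2, integral_limitDensity_mul_sq hp, sq, Finset.sum_mul_sum,
    Finset.sum_div, ← Finset.sum_sub_distrib]
  simp only [dotProduct, Matrix.mulVec, limitCov, Matrix.of_apply, Finset.mul_sum]
  refine Finset.sum_congr rfl fun i _ => ?_
  rw [Finset.sum_div, ← Finset.sum_sub_distrib]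
  refine Finset.sum_congr rfl fun j _ => ?_
  ring

lemma posSemidef_limitCov {C p : ℝ} (hC : 0 < C) (hp : 0 < p) {u : Fin q → ℝ} (hu : ∀ j, 0 < u j)
    (hmono : StrictMono u) : (limitCov C p u).PosSemidef := by
  refine Matrix.PosSemidef.of_dotProduct_mulVec_nonneg ?_ fun ξ => ?_
  · ext i j
    simp [limitCov, max_comm i j, mul_comm]
  · rw [star_trivial, ← condVariance_combProfile hp hu hmono]
    exact condVariance_nonneg hC hp (boundedProfile_combProfile u ξ)

end Covariance

/-! ### The central limit theorem and the fluctuations -/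

lemma tendstoInDistribution_nuHatVec {C p : ℝ} {a : ℕ → ℝ} {δ : ℕ → ℝ}
    (H : TiltRegime C p a (scaling C p) δ)
    (hδ : ∀ N : ℕ, 1 ≤ N →
      ∑ k ∈ Finset.Icc 1 N, (k : ℝ) * a k * Real.exp (-δ N * k) = (N : ℝ))
    {q : ℕ} [NeZero q] {u : Fin q → ℝ} (hu : ∀ j, 0 < u j) (hmono : StrictMono u)
    {rd : ℝ → ℕ} (hrd : IsRounding rd) :
    TendstoInDistribution
      (fun (N : ℕ) (η : Nat.Partition N) => nuHatVec C p a (δ N) rd u η) atTop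
      (id : EuclideanSpace ℝ (Fin q) → EuclideanSpace ℝ (Fin q))
      (fun N => (gibbs a H.a_pos N).toMeasure)
      (multivariateGaussian 0 (limitCov C p u)) where
  forall_aemeasurable N := (measurable_of_finite _).aemeasurable
  tendsto := by
    refine ProbabilityMeasure.tendsto_iff_tendsto_charFun.2 fun ξ => ?_
    have hpsd := posSemidef_limitCov H.C_pos H.p_pos hu hmono
    simp only [ProbabilityMeasure.coe_mk, Measure.map_id]
    rw [charFun_multivariateGaussian hpsd, inner_zero_right,
      ← condVariance_combProfile H.p_pos hu hmono ξ]
    set κ := TiltRegime.normRatio C p a (scaling C p) δ rd (u 0) with hκ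
    have hκ1 : Tendsto κ atTop (𝓝 1) := H.tendsto_normRatio hrd (hu 0)
    have hg : TiltRegime.HasProfile (scaling C p)
        (fun N k => κ N * ∑ j, ξ j * tailInd (rd (u j * scaling C p N)) k)
        (combProfile u ξ) := by
      refine ⟨⟨2 * ∑ j, |ξ j|, ?_⟩, ?_⟩
      · filter_upwards [hκ1.abs.eventually_le_const (show |(1 : ℝ)| < 2 by norm_num)] with N hN k _
        rw [abs_mul]
        gcongr
        refine (Finset.abs_sum_le_sum_abs _ _).trans (Finset.sum_le_sum fun j _ => ?_)
        rw [abs_mul]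
        exact mul_le_of_le_one_right (abs_nonneg _) (abs_tailInd_le _ _)
      · have h : ∀ᵐ x ∂volume.restrict (Set.Ioi (0 : ℝ)), ∀ j, Tendsto (fun N =>
            tailInd (rd (u j * scaling C p N)) ⌈scaling C p N * x⌉₊) atTop
            (𝓝 (tailProfile (u j) x)) :=
          ae_all_iff.2 fun j => hrd.tendsto_tailInd H.scale (hu j).le
        filter_upwards [h] with x hx
        have h2 := hκ1.mul (tendsto_finsetSum Finset.univ fun j _ => (hx j).const_mul (ξ j))
        rw [one_mul] at h2
        exact h2
    have hmain := H.tendsto_gibbs_charFun hδ hg (boundedProfile_combProfile u ξ)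
    have e : (Complex.exp (((0 : ℝ) : ℂ) * Complex.I -
        (condVariance C p (combProfile u ξ) : ℂ) / 2)) =
        (Real.exp (-(1 / 2) * condVariance C p (combProfile u ξ)) : ℂ) := by
      push_cast
      congr 1
      ring
    rw [e]
    refine hmain.congr' ?_
    filter_upwards [H.scale.eventually_gt_atTop 0] with N hN
    rw [charFun_apply, integral_map (measurable_of_finite _).aemeasurable
      (by fun_prop : Continuous _).aestronglyMeasurable]
    refine integral_congr_ae (Eventually.of_forall fun η => ?_)
    simp only
    congr 3
    rw [PiLp.inner_apply]
    have h3 : ∀ j, nuHatVec C p a (δ N) rd u η j = κ N * ((scaling C p N ^ (p / 2))⁻¹ *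
        ∑ k ∈ Finset.Icc 1 N, tailInd (rd (u j * scaling C p N)) k *
          (mult η k - a k * Real.exp (-δ N * k))) := by
      intro j
      simp only [nuHatVec]
      rw [TiltRegime.nuHat_eq hN, TiltRegime.young_sub_sumAbove]
    simp only [h3, Finset.mul_sum, Finset.sum_mul, RCLike.inner_apply, conj_trivial]
    rw [Finset.sum_comm]
    refine Finset.sum_congr rfl fun j _ => Finset.sum_congr rfl fun k _ => ?_
    ring

/-- The identity behind the relation to the fluctuations: the additive error is the deviation of
the scaled Poisson mean from the limit curve. -/
lemma nuHatVec_eq_fluctuation {C p : ℝ} {a : ℕ → ℝ} {δ : ℕ → ℝ} (hC : 0 < C) (hp : 0 < p)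
    {q : ℕ} [NeZero q] (u : Fin q → ℝ) {N : ℕ} (hN : 1 ≤ N) (η : Nat.Partition N) (j : Fin q) :
    nuHatVec C p a (δ N) (fun x => ⌈x⌉₊) u η j =
      TiltRegime.normRatio C p a (scaling C p) δ (fun x => ⌈x⌉₊) (u 0) N *
        fluctuationFactor C p N * (fluctuation C p η (u j) + (limitCurve p (u j) -
          scaling C p N / N * sumAbove a (δ N) N ⌈u j * scaling C p N⌉₊)) := by
  have hΓ := Real.Gamma_pos_of_pos (show 0 < p + 1 by linarith)
  have hr := scaling_pos hC hp hN
  have hN0 : (0 : ℝ) < N := by exact_mod_cast hN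
  have hNr := scaling_rpow hC hp N
  rw [Real.rpow_add_one hr.ne'] at hNr
  have hr2 : 0 < scaling C p N ^ (p / 2) := Real.rpow_pos_of_pos hr _
  have hsq : scaling C p N ^ p = (scaling C p N ^ (p / 2)) ^ 2 := by
    rw [← Real.rpow_natCast, ← Real.rpow_mul hr.le]; norm_num
  have hF : fluctuationFactor C p N = C * Real.Gamma (p + 1) * scaling C p N ^ (p / 2) := by
    rw [fluctuationFactor, Real.sqrt_eq_iff_mul_self_eq (by positivity) (by positivity)]
    rw [← hNr]
    rw [hsq]
    field_simp
  simp only [nuHatVec]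
  rw [TiltRegime.nuHat_eq (rd := fun x => ⌈x⌉₊) hr, young_ceil, hF, fluctuation, scaledYoung,
    mul_comm (u j)]
  rw [mul_assoc (TiltRegime.normRatio _ _ _ _ _ _ _ _)]
  congr 1
  have e : C * Real.Gamma (p + 1) * scaling C p N ^ (p / 2) * (scaling C p N / N) =
      (scaling C p N ^ (p / 2))⁻¹ := by
    rw [← hNr, hsq]
    field_simp
  rw [← e]
  ring

lemma bFun_eq_limitCurve {C p : ℝ} (hp : 0 < p) (u : ℝ) :
    bFun C (p - 1) u = C * Real.Gamma (p + 1) * limitCurve p u := by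
  have hΓ := Real.Gamma_pos_of_pos (show 0 < p + 1 by linarith)
  rw [bFun, limitCurve, sub_add_cancel]
  field_simp

lemma TiltRegime.tendsto_scaled_sumAbove {C p : ℝ} {a : ℕ → ℝ} {δ : ℕ → ℝ}
    (H : TiltRegime C p a (scaling C p) δ) {rd : ℝ → ℕ} (hrd : IsRounding rd) {u : ℝ}
    (hu : 0 ≤ u) :
    Tendsto (fun N : ℕ => scaling C p N / N * sumAbove a (δ N) N (rd (u * scaling C p N))) atTop
      (𝓝 (limitCurve p u)) := by
  have hC := H.C_pos
  have hp := H.p_pos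
  have hΓ := Real.Gamma_pos_of_pos (show 0 < p + 1 by linarith)
  have h := (H.tendsto_sumAbove hrd hu).const_mul (C * Real.Gamma (p + 1))⁻¹
  rw [bFun_eq_limitCurve hp, inv_mul_cancel_left₀ (by positivity)] at h
  refine h.congr' ?_
  filter_upwards [eventually_ge_atTop 1] with N hN
  have hr := scaling_pos hC hp hN
  have hNr := scaling_rpow hC hp N
  rw [Real.rpow_add_one hr.ne'] at hNr
  have e : scaling C p N / N = (C * Real.Gamma (p + 1))⁻¹ * (scaling C p N ^ p)⁻¹ := by
    have := Real.rpow_pos_of_pos hr p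
    rw [← hNr]
    field_simp
  rw [e, mul_assoc]

/-- Multiplicative and additive corrections which are `1 + o(1)` and `o(1)` preserve asymptotic
equivalence along sequences bounded away from zero. -/
lemma isEquivalent_mul_add {α ε x f y : ℕ → ℝ} (hα : Tendsto α atTop (𝓝 1))
    (hε : Tendsto ε atTop (𝓝 0)) {c : ℝ} (hc : 0 < c) (hx : ∀ᶠ N in atTop, c ≤ |x N|)
    (hy : ∀ᶠ N in atTop, y N = α N * f N * (x N + ε N)) :
    y ~[atTop] fun N => f N * x N := by
  refine isEquivalent_iff_exists_eq_mul.2 ⟨fun N => α N * (1 + ε N / x N), ?_, ?_⟩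
  · have h : Tendsto (fun N => ε N / x N) atTop (𝓝 0) := by
      refine squeeze_zero_norm' ?_ (by simpa using hε.abs.div_const c)
      filter_upwards [hx] with N hN
      rw [norm_div, Real.norm_eq_abs, Real.norm_eq_abs]
      gcongr
    simpa using hα.mul (tendsto_const_nhds.add h)
  · filter_upwards [hx, hy] with N hN hyN
    have : x N ≠ 0 := abs_pos.1 (hc.trans_le hN)
    rw [hyN, Pi.mul_apply]
    field_simp

/-! ### The limit shape -/

lemma integrableOn_gammaIntegrand {p : ℝ} (hp : 0 < p) :
    IntegrableOn (fun x : ℝ => x ^ (p - 1) * Real.exp (-x)) (Set.Ioi 0) := by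
  simpa only [mul_comm] using Real.GammaIntegral_convergent hp

lemma gammaIntegrand_nonneg (p : ℝ) {u x : ℝ} (hu : 0 ≤ u) (hx : x ∈ Set.Ioi u) :
    0 ≤ x ^ (p - 1) * Real.exp (-x) := by
  have : 0 < x := hu.trans_lt hx
  positivity

lemma upperGamma_nonneg (p : ℝ) {u : ℝ} (hu : 0 ≤ u) : 0 ≤ upperGamma p u :=
  setIntegral_nonneg measurableSet_Ioi fun _ hx => gammaIntegrand_nonneg p hu hx

lemma antitoneOn_upperGamma {p : ℝ} (hp : 0 < p) : AntitoneOn (upperGamma p) (Set.Ici 0) := by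
  intro u hu v _ huv
  refine setIntegral_mono_set
    ((integrableOn_gammaIntegrand hp).mono_set (Set.Ioi_subset_Ioi hu)) ?_
    (Set.Ioi_subset_Ioi huv).eventuallyLE
  filter_upwards [ae_restrict_mem measurableSet_Ioi] with x hx
  exact gammaIntegrand_nonneg p hu hx

lemma continuousOn_upperGamma {p : ℝ} (hp : 0 < p) :
    ContinuousOn (upperGamma p) (Set.Ici 0) := by
  set f : ℝ → ℝ := (Set.Ioi 0).indicator fun x => x ^ (p - 1) * Real.exp (-x) with hf
  have hint : Integrable f :=
    (integrableOn_gammaIntegrand hp).integrable_indicator measurableSet_Ioi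
  have hc : Continuous fun u => (∫ x in Set.Ioi 0, f x) - ∫ x in (0 : ℝ)..u, f x :=
    continuous_const.sub
      (intervalIntegral.continuous_primitive (fun a b => hint.intervalIntegrable) 0)
  refine hc.continuousOn.congr fun u hu => ?_
  have h := intervalIntegral.integral_interval_add_Ioi (a := 0) (b := u)
    hint.integrableOn hint.integrableOn
  simp only
  rw [← h, add_sub_cancel_left, upperGamma]
  refine setIntegral_congr_fun measurableSet_Ioi fun x hx => ?_
  have hx0 : x ∈ Set.Ioi (0 : ℝ) := Set.mem_Ioi.2 ((Set.mem_Ici.1 hu).trans_lt hx)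
  simp only [hf, Set.indicator_of_mem hx0]

/-- Tonelli, in the form of the layer cake formula for the Gamma density. -/
lemma integral_upperGamma {p : ℝ} (hp : 0 < p) :
    ∫ u in Set.Ioi (0 : ℝ), upperGamma p u = Real.Gamma (p + 1) := by
  set f : ℝ → NNReal := fun x => (x ^ (p - 1) * Real.exp (-x)).toNNReal with hf
  have hfm : Measurable f := by fun_prop
  set μ : Measure ℝ := (volume.restrict (Set.Ioi 0)).withDensity fun x => (f x : ENNReal) with hμ
  have hae : ∀ᵐ x ∂μ, 0 ≤ x := by
    refine (withDensity_absolutelyContinuous _ _).ae_le ?_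
    filter_upwards [ae_restrict_mem measurableSet_Ioi] with x hx using le_of_lt hx
  have hfx : ∀ x ∈ Set.Ioi (0 : ℝ), f x • x = Real.exp (-x) * x ^ (p + 1 - 1) := by
    intro x hx
    have hx : 0 < x := hx
    have : x ^ (p + 1 - 1) = x ^ (p - 1) * x := by rw [← Real.rpow_add_one hx.ne']; ring_nf
    rw [this, NNReal.smul_def, hf, Real.coe_toNNReal _ (by positivity), smul_eq_mul]
    ring
  have hint : Integrable (fun x => x) μ := by
    rw [integrable_withDensity_iff_integrable_smul hfm]
    exact (Real.GammaIntegral_convergent (by linarith : 0 < p + 1)).congr_fun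
      (fun x hx => (hfx x hx).symm) measurableSet_Ioi
  have h := hint.integral_eq_integral_meas_lt hae
  rw [integral_withDensity_eq_integral_smul hfm,
    setIntegral_congr_fun measurableSet_Ioi hfx, ← Real.Gamma_eq_integral (by linarith)] at h
  rw [h]
  refine setIntegral_congr_fun measurableSet_Ioi fun u hu => ?_
  have hu : 0 ≤ u := le_of_lt hu
  have hset : {a : ℝ | u < a} = Set.Ioi u := rfl
  rw [hset, measureReal_def, withDensity_apply _ measurableSet_Ioi,
    Measure.restrict_restrict measurableSet_Ioi,
    Set.inter_eq_self_of_subset_left (Set.Ioi_subset_Ioi hu), upperGamma,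
    integral_eq_lintegral_of_nonneg_ae]
  · rfl
  · filter_upwards [ae_restrict_mem measurableSet_Ioi] with x hx
    exact gammaIntegrand_nonneg p hu hx
  · exact ((integrableOn_gammaIntegrand hp).mono_set
      (Set.Ioi_subset_Ioi hu)).aestronglyMeasurable

lemma antitoneOn_limitCurve {p : ℝ} (hp : 0 < p) : AntitoneOn (limitCurve p) (Set.Ici 0) := by
  intro u hu v hv huv
  have hΓ := Real.Gamma_pos_of_pos (show 0 < p + 1 by linarith)
  exact div_le_div_of_nonneg_right (antitoneOn_upperGamma hp hu hv huv) hΓ.le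

lemma isShape_limitCurve {p : ℝ} (hp : 0 < p) : IsShape (limitCurve p) := by
  have hΓ := Real.Gamma_pos_of_pos (show 0 < p + 1 by linarith)
  have h1 : ∫ u in Set.Ioi (0 : ℝ), limitCurve p u = 1 := by
    simp only [limitCurve]
    rw [integral_div, integral_upperGamma hp, div_self hΓ.ne']
  refine ⟨fun u hu => div_nonneg (upperGamma_nonneg p hu) hΓ.le, antitoneOn_limitCurve hp, ?_, h1⟩
  -- A function which is not integrable has integral zero.
  by_contra h
  rw [integral_undef h] at h1
  exact zero_ne_one h1

lemma continuousOn_limitCurve (p : ℝ) (hp : 0 < p) : ContinuousOn (limitCurve p) (Set.Ici 0) :=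
  (continuousOn_upperGamma hp).div_const _

lemma antitone_young {N : ℕ} (η : Nat.Partition N) : Antitone (young η) := by
  intro u v huv
  refine Finset.sum_le_sum_of_subset_of_nonneg (fun k hk => ?_) fun k _ _ => Nat.cast_nonneg _
  rw [Finset.mem_filter] at hk ⊢
  exact ⟨hk.1, huv.trans hk.2⟩

lemma antitone_scaledYoung {N : ℕ} {r : ℝ} (hr : 0 ≤ r) (η : Nat.Partition N) :
    Antitone (scaledYoung r η) := fun _ _ huv =>
  mul_le_mul_of_nonneg_left (antitone_young η (mul_le_mul_of_nonneg_left huv hr)) (by positivity)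

/-- Closeness of an antitone function to a continuous antitone function, uniformly on `[0, b]`,
follows from closeness at finitely many points. -/
lemma exists_finset_forall_abs_sub_lt {l : ℝ → ℝ} (hc : ContinuousOn l (Set.Ici 0)) (b : ℝ)
    {ε : ℝ} (hε : 0 < ε) :
    ∃ s : Finset ℝ, (∀ v ∈ s, 0 ≤ v) ∧ ∀ f : ℝ → ℝ, Antitone f →
      (∀ v ∈ s, |f v - l v| < ε / 2) → ∀ u ∈ Set.Icc 0 b, |f u - l u| < ε := by
  have huc : UniformContinuousOn l (Set.Icc 0 (b + 1)) :=
    isCompact_Icc.uniformContinuousOn_of_continuous (hc.mono fun x hx => hx.1)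
  obtain ⟨d, hd, hl⟩ := Metric.uniformContinuousOn_iff.1 huc (ε / 2) (half_pos hε)
  set h := min (d / 2) 1 with hh
  have hh0 : 0 < h := lt_min (half_pos hd) one_pos
  have hhd : h < d := (min_le_left _ _).trans_lt (half_lt_self hd)
  have hh1 : h ≤ 1 := min_le_right _ _
  refine ⟨(Finset.range (⌊b / h⌋₊ + 2)).image fun i : ℕ => (i : ℝ) * h, fun v hv => ?_,
    fun f hf hfv u hu => ?_⟩
  · obtain ⟨i, _, rfl⟩ := Finset.mem_image.1 hv
    positivity
  · set i := ⌊u / h⌋₊ with hi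
    have hu0 := hu.1
    have h1 : (i : ℝ) * h ≤ u := (le_div_iff₀ hh0).1 (Nat.floor_le (by positivity))
    have h2 : u < ((i + 1 : ℕ) : ℝ) * h := by
      rw [← div_lt_iff₀ hh0]; exact_mod_cast Nat.lt_floor_add_one _
    have h3 : ((i + 1 : ℕ) : ℝ) * h = i * h + h := by push_cast; ring
    have hib : i ≤ ⌊b / h⌋₊ := Nat.floor_le_floor (by gcongr; exact hu.2)
    have hub := hu.2
    have hi0 : (0 : ℝ) ≤ i * h := by positivity
    have a1 := hfv (i * h) (Finset.mem_image_of_mem _ (Finset.mem_range.2 (by omega)))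
    have a2 := hfv ((i + 1 : ℕ) * h)
      (Finset.mem_image.2 ⟨i + 1, Finset.mem_range.2 (by omega), rfl⟩)
    have b1 := hl (i * h) ⟨hi0, by linarith⟩ u ⟨hu0, by linarith⟩
      (by rw [Real.dist_eq, abs_lt]; constructor <;> linarith)
    have b2 := hl ((i + 1 : ℕ) * h) ⟨by positivity, by linarith⟩ u ⟨hu0, by linarith⟩
      (by rw [Real.dist_eq, abs_lt]; constructor <;> linarith)
    have c1 := hf h1
    have c2 := hf h2.le
    rw [Real.dist_eq] at b1 b2
    rw [abs_lt] at a1 a2 b1 b2 ⊢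
    constructor <;> linarith [a1.1, a1.2, a2.1, a2.2, b1.1, b1.2, b2.1, b2.2]

lemma tendsto_measure_biInter_one {Ω : ℕ → Type*} [∀ N, MeasurableSpace (Ω N)]
    {P : ∀ N, Measure (Ω N)} [∀ N, IsProbabilityMeasure (P N)] {ι : Type*} (s : Finset ι)
    {A : ι → ∀ N, Set (Ω N)} (hA : ∀ i N, MeasurableSet (A i N))
    (h : ∀ i ∈ s, Tendsto (fun N => P N (A i N)) atTop (𝓝 1)) :
    Tendsto (fun N => P N (⋂ i ∈ s, A i N)) atTop (𝓝 1) := by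
  have h0 : ∀ i ∈ s, Tendsto (fun N => P N (A i N)ᶜ) atTop (𝓝 0) := by
    intro i hi
    simp_rw [prob_compl_eq_one_sub (hA i _)]
    have := ENNReal.Tendsto.sub (tendsto_const_nhds (x := (1 : ENNReal))) (h i hi)
      (Or.inl ENNReal.one_ne_top)
    simpa using this
  have h1 : Tendsto (fun N => ∑ i ∈ s, P N (A i N)ᶜ) atTop (𝓝 0) := by
    simpa using tendsto_finsetSum s h0
  have h2 : Tendsto (fun N => 1 - ∑ i ∈ s, P N (A i N)ᶜ) atTop (𝓝 1) := by
    have := ENNReal.Tendsto.sub (tendsto_const_nhds (x := (1 : ENNReal))) h1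
      (Or.inl ENNReal.one_ne_top)
    simpa using this
  refine tendsto_of_tendsto_of_tendsto_of_le_of_le h2 tendsto_const_nhds (fun N => ?_)
    fun N => prob_le_one
  rw [tsub_le_iff_right]
  have hm : MeasurableSet (⋂ i ∈ s, A i N) := Finset.measurableSet_biInter s fun i _ => hA i N
  rw [← prob_add_prob_compl (μ := P N) hm]
  gcongr
  rw [Set.compl_iInter₂]
  exact measure_biUnion_finset_le _ _

/-- Convergence in probability to zero from convergence of the characteristic functions. -/
lemma tendsto_measure_abs_lt_of_charFun {Ω : ℕ → Type*} [∀ N, MeasurableSpace (Ω N)]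
    {P : ∀ N, Measure (Ω N)} [∀ N, IsProbabilityMeasure (P N)] {X : ∀ N, Ω N → ℝ}
    (hX : ∀ N, Measurable (X N))
    (h : ∀ ξ : ℝ, Tendsto (fun N => ∫ ω, Complex.exp ((ξ * X N ω : ℝ) * Complex.I) ∂P N) atTop
      (𝓝 1)) {ε : ℝ} (hε : 0 < ε) :
    Tendsto (fun N => P N {ω | |X N ω| < ε}) atTop (𝓝 1) := by
  set Q : ℕ → ProbabilityMeasure ℝ := fun N =>
    ⟨(P N).map (X N), Measure.isProbabilityMeasure_map (hX N).aemeasurable⟩ with hQ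
  set Q0 : ProbabilityMeasure ℝ := ⟨Measure.dirac 0, inferInstance⟩ with hQ0
  have hlim : Tendsto Q atTop (𝓝 Q0) := by
    refine ProbabilityMeasure.tendsto_iff_tendsto_charFun.2 fun ξ => ?_
    simp only [hQ, hQ0, ProbabilityMeasure.coe_mk, charFun_apply_real]
    rw [integral_dirac]
    simp only [Complex.ofReal_zero, mul_zero, zero_mul, Complex.exp_zero]
    refine (h ξ).congr fun N => ?_
    rw [integral_map (hX N).aemeasurable (by fun_prop : Continuous _).aestronglyMeasurable]
    simp only [Complex.ofReal_mul]
  have hfr : (Q0 : Measure ℝ) (frontier (Metric.ball 0 ε)) = 0 := by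
    simp only [hQ0, ProbabilityMeasure.coe_mk]
    rw [frontier_ball _ hε.ne', Measure.dirac_apply' _ Metric.isClosed_sphere.measurableSet,
      Set.indicator_of_notMem]
    simp [hε.ne]
  have h1 := ProbabilityMeasure.tendsto_measure_of_null_frontier_of_tendsto' hlim hfr
  have h2 : (Q0 : Measure ℝ) (Metric.ball 0 ε) = 1 := by
    simp only [hQ0, ProbabilityMeasure.coe_mk]
    exact Measure.dirac_apply_of_mem (Metric.mem_ball_self hε)
  rw [h2] at h1
  refine h1.congr fun N => ?_
  simp only [hQ, ProbabilityMeasure.coe_mk]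
  rw [Measure.map_apply (hX N) measurableSet_ball]
  congr 1
  ext ω
  simp

/-- The weak law of large numbers for the Young diagram at one point, including `u = 0`. -/
lemma tendsto_measure_scaledYoung {C p : ℝ} {a : ℕ → ℝ} {δ : ℕ → ℝ}
    (H : TiltRegime C p a (scaling C p) δ)
    (hδ : ∀ N : ℕ, 1 ≤ N →
      ∑ k ∈ Finset.Icc 1 N, (k : ℝ) * a k * Real.exp (-δ N * k) = (N : ℝ))
    {u : ℝ} (hu : 0 ≤ u) {ε : ℝ} (hε : 0 < ε) :
    Tendsto (fun N => (gibbs a H.a_pos N).toMeasure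
      {η | |scaledYoung (scaling C p N) η u - limitCurve p u| < ε}) atTop (𝓝 1) := by
  have hC := H.C_pos
  have hp := H.p_pos
  have hΓ := Real.Gamma_pos_of_pos (show 0 < p + 1 by linarith)
  set M : ℕ → ℕ := fun N => ⌈u * scaling C p N⌉₊ with hM
  set X : ∀ N, Nat.Partition N → ℝ := fun N η =>
    scaling C p N / N * (young η (M N) - sumAbove a (δ N) N (M N)) with hX
  have hpow : Tendsto (fun N => (scaling C p N ^ (p / 2))⁻¹) atTop (𝓝 0) :=
    ((tendsto_rpow_atTop (half_pos hp)).comp H.scale).inv_tendsto_atTop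
  have hchar : ∀ ξ : ℝ, Tendsto (fun N => ∫ η, Complex.exp ((ξ * X N η : ℝ) * Complex.I)
      ∂(gibbs a H.a_pos N).toMeasure) atTop (𝓝 1) := by
    intro ξ
    set c : ℕ → ℝ := fun N => ξ * ((C * Real.Gamma (p + 1))⁻¹ * (scaling C p N ^ (p / 2))⁻¹) with hc
    have hc0 : Tendsto c atTop (𝓝 0) := by
      have := (hpow.const_mul (C * Real.Gamma (p + 1))⁻¹).const_mul ξ
      rwa [mul_zero, mul_zero] at this
    -- On this scale the coefficients tend to zero, so that the limiting variance vanishes.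
    have hg : TiltRegime.HasProfile (scaling C p) (fun N k => c N * tailInd (M N) k)
        (fun _ => 0) := by
      refine ⟨⟨1, ?_⟩, ?_⟩
      · have hca : Tendsto (fun N => |c N|) atTop (𝓝 0) := by simpa using hc0.abs
        filter_upwards [hca.eventually_le_const one_pos] with N hN k _
        rw [abs_mul]
        exact mul_le_one₀ hN (abs_nonneg _) (abs_tailInd_le _ _)
      · filter_upwards [isRounding_ceil.tendsto_tailInd H.scale hu] with x hx
        simpa using hc0.mul hx
    have h0 : BoundedProfile fun _ => 0 := ⟨measurable_const, 0, fun x => by simp⟩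
    have h := H.tendsto_gibbs_charFun hδ hg h0
    have hv : condVariance C p (fun _ => 0) = 0 := by simp [condVariance]
    rw [hv, mul_zero, Real.exp_zero, Complex.ofReal_one] at h
    refine h.congr' ?_
    filter_upwards [eventually_ge_atTop 1] with N hN
    refine integral_congr_ae (Eventually.of_forall fun η => ?_)
    simp only
    congr 3
    have hr := scaling_pos hC hp hN
    have hNr := scaling_rpow hC hp N
    rw [Real.rpow_add_one hr.ne'] at hNr
    have hr2 : 0 < scaling C p N ^ (p / 2) := Real.rpow_pos_of_pos hr _
    have hsq : scaling C p N ^ p = (scaling C p N ^ (p / 2)) ^ 2 := by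
      rw [← Real.rpow_natCast, ← Real.rpow_mul hr.le]; norm_num
    have e : scaling C p N / N = (C * Real.Gamma (p + 1))⁻¹ * (scaling C p N ^ (p / 2))⁻¹ *
        (scaling C p N ^ (p / 2))⁻¹ := by
      rw [← hNr, hsq]
      field_simp
    simp only [hX]
    rw [e, TiltRegime.young_sub_sumAbove, Finset.mul_sum, Finset.mul_sum]
    refine Finset.sum_congr rfl fun k _ => ?_
    simp only [hc]
    ring
  have h1 := tendsto_measure_abs_lt_of_charFun (P := fun N => (gibbs a H.a_pos N).toMeasure)
    (fun N => measurable_of_finite (X N)) hchar (half_pos hε)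
  refine tendsto_of_tendsto_of_tendsto_of_le_of_le' h1 tendsto_const_nhds ?_
    (Eventually.of_forall fun N => prob_le_one)
  have hS := H.tendsto_scaled_sumAbove isRounding_ceil hu
  filter_upwards [(Metric.tendsto_nhds.1 hS) (ε / 2) (half_pos hε)] with N hN
  refine measure_mono fun η hη => ?_
  have hη : |X N η| < ε / 2 := hη
  rw [Real.dist_eq] at hN
  change |scaledYoung (scaling C p N) η u - limitCurve p u| < ε
  have e : scaledYoung (scaling C p N) η u - limitCurve p u =
      X N η + (scaling C p N / N * sumAbove a (δ N) N (M N) - limitCurve p u) := by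
    simp only [hX, hM, scaledYoung]
    rw [young_ceil, mul_comm u]
    ring
  rw [e]
  exact (abs_add_le _ _).trans_lt (by linarith)

theorem isLimitShape_gibbs {C p : ℝ} {a : ℕ → ℝ} {δ : ℕ → ℝ}
    (H : TiltRegime C p a (scaling C p) δ)
    (hδ : ∀ N : ℕ, 1 ≤ N →
      ∑ k ∈ Finset.Icc 1 N, (k : ℝ) * a k * Real.exp (-δ N * k) = (N : ℝ)) :
    IsLimitShape (gibbs a H.a_pos) (scaling C p) (limitCurve p) where
  isShape := isShape_limitCurve H.p_pos
  continuousOn := continuousOn_limitCurve p H.p_pos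
  scaling_pos N hN := scaling_pos H.C_pos H.p_pos hN
  scaling_isLittleO := by
    refine (isLittleO_iff_tendsto' ?_).2 ?_
    · filter_upwards [eventually_ge_atTop 1] with N hN h
      have : (0 : ℝ) < N := by exact_mod_cast hN
      exact absurd h this.ne'
    · simpa [Pi.inv_def] using H.cutoff.inv_tendsto_atTop
  tendsto b _ ε hε := by
    obtain ⟨s, hs, h⟩ := exists_finset_forall_abs_sub_lt (continuousOn_limitCurve p H.p_pos) b hε
    have h1 := tendsto_measure_biInter_one (P := fun N => (gibbs a H.a_pos N).toMeasure) s
      (A := fun v N => {η | |scaledYoung (scaling C p N) η v - limitCurve p v| < ε / 2})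
      (fun _ _ => MeasurableSet.of_discrete)
      fun v hv => tendsto_measure_scaledYoung H hδ (hs v hv) (half_pos hε)
    refine tendsto_of_tendsto_of_tendsto_of_le_of_le' h1 tendsto_const_nhds ?_
      (Eventually.of_forall fun N => prob_le_one)
    filter_upwards [eventually_ge_atTop 1] with N hN
    refine measure_mono fun η hη => ?_
    exact h _ (antitone_scaledYoung (scaling_pos H.C_pos H.p_pos hN).le η)
      fun v hv => Set.mem_iInter₂.1 hη v hv

end GibbsPartition

open GibbsPartition
theorem theorem4p3 (C p : ℝ) (hC : 0 < C) (hp : 0 < p)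
    (a : ℕ → ℝ) (ha : ∀ k, 1 ≤ k → 0 < a k)
    (hasymp : (fun k : ℕ => a k) ~[atTop] fun k : ℕ => C * (k : ℝ) ^ (p - 1))
    (δ : ℕ → ℝ)
    (hδ : ∀ N : ℕ, 1 ≤ N →
      ∑ k ∈ Finset.Icc 1 N, (k : ℝ) * a k * Real.exp (-δ N * k) = (N : ℝ))
    (q : ℕ) [NeZero q] (u : Fin q → ℝ) (hu : ∀ j, 0 < u j) (hu_mono : StrictMono u) :
    -- the central limit theorem, whichever way the stratification points are rounded
    ((limitCov C p u).PosSemidef ∧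
      ∀ rd : ℝ → ℕ, (rd = fun x => ⌊x⌋₊) ∨ (rd = fun x => ⌈x⌉₊) →
        TendstoInDistribution
          (fun (N : ℕ) (η : Nat.Partition N) => nuHatVec C p a (δ N) rd u η) atTop
          (id : EuclideanSpace ℝ (Fin q) → EuclideanSpace ℝ (Fin q))
          (fun N => (gibbs a ha N).toMeasure)
          (multivariateGaussian 0 (limitCov C p u))) ∧
    -- the relation to the fluctuations, for all partitions of `N`
    (∀ j : Fin q,
      (∃ α ε : ℕ → ℝ, Tendsto α atTop (𝓝 1) ∧ Tendsto ε atTop (𝓝 0) ∧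
        ∀ᶠ N : ℕ in atTop, ∀ η : Nat.Partition N,
          nuHatVec C p a (δ N) (fun x => ⌈x⌉₊) u η j =
            α N * fluctuationFactor C p N * (fluctuation C p η (u j) + ε N)) ∧
      (∀ (η : (N : ℕ) → Nat.Partition N) (c : ℝ), 0 < c →
        (∀ᶠ N : ℕ in atTop, c ≤ |fluctuation C p (η N) (u j)|) →
        (fun N : ℕ => nuHatVec C p a (δ N) (fun x => ⌈x⌉₊) u (η N) j) ~[atTop]
          fun N : ℕ => fluctuationFactor C p N * fluctuation C p (η N) (u j))) ∧
    -- the limit shape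
    IsLimitShape (gibbs a ha) (scaling C p) (limitCurve p) := by
  have H : TiltRegime C p a (scaling C p) δ := tiltRegime_scaling hC hp ha hasymp hδ
  refine ⟨⟨posSemidef_limitCov hC hp hu hu_mono, fun rd hrd => ?_⟩, fun j => ?_,
    isLimitShape_gibbs H hδ⟩
  · have hrd' : IsRounding rd := by
      rcases hrd with rfl | rfl
      · exact isRounding_floor
      · exact isRounding_ceil
    exact tendstoInDistribution_nuHatVec H hδ hu hu_mono hrd'
  · have hα := H.tendsto_normRatio isRounding_ceil (hu 0)
    have hε := tendsto_const_nhds (x := limitCurve p (u j)) |>.sub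
      (H.tendsto_scaled_sumAbove isRounding_ceil (hu j).le)
    rw [sub_self] at hε
    refine ⟨⟨_, _, hα, hε, ?_⟩, fun η c hc hx => isEquivalent_mul_add hα hε hc hx ?_⟩
    all_goals filter_upwards [eventually_ge_atTop 1] with N hN
    · exact fun η => nuHatVec_eq_fluctuation hC hp u hN η j
    · exact nuHatVec_eq_fluctuation hC hp u hN (η N) j
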